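/- Let $m\ge 1$ be an integer, let $k$ be a commutative Noetherian ring, and let $\mathscr{FI}^m$ be the $m$-fold product of the category $\mathscr{FI}$ whose objects are the sets $[n]=\{1,\dots,n\}$, $n\in\mathbb N=\{0,1,2,\dots\}$, and whose morphisms are the injections. An $\mathscr{FI}^m$-module $V$ is a functor from $\mathscr{FI}^m$ to $k$-modules; write $V_{\mathbf n}$ for its value at $[n_1]\times\dots\times[n_m]$ if $\mathbf n\in\mathbb N^m$, and $V_{\mathbf n}=0$ if $\mathbf n\in\mathbb Z^m\setminus\mathbb N^m$. It is finitely generated if there are finitely many elements of $\bigsqcup_{\mathbf n}V_{\mathbf n}$ that are not all contained in any proper submodule. A transition map of $V$ is a map induced by a non-invertible morphism of $\mathscr{FI}^m$. The $\mathscr{FI}^m$-homology functors $H_i$ are the left derived functors of $V\mapsto H_0(V)$, $H_0(V)_{\mathbf n}=V_{\mathbf n}/V_{<\mathbf n}$, where $V_{<\mathbf n}\subseteq V_{\mathbf n}$ is the $k$-submodule generated by the images of all transition maps into $V_{\mathbf n}$. The local cohomology functors $H^i_B$ are the right derived functors of the functor sending $V$ to its submodule $V_T$ of $B$-torsion elements,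 that is, of all elements $v\in V_{\mathbf n}$ lying in the kernel of some transition map out of $V_{\mathbf n}$. For $\mathbf a\in\mathbb N^m$ put $|\mathbf a|=\sum_j a_j$, and let $e_1,\dots,e_m$ be the standard basis vectors. Define $$\mathrm{HD}_i(V)=\Big\{\mathbf r\in\mathbb Z^m : H_i(V)_{\mathbf n}=0\text{ for all }\mathbf n\in\bigcup_{j}(\mathbf r+e_j+\mathbb N^m)\Big\},$$ $$\mathrm{CMreg}_+(V)=\Big\{\mathbf r\in\mathbb Z^m : H^i_B(V)_{\mathbf n}=0\text{ for all } i\ge 0\text{ and all }\mathbf n\in\bigcup_{\mathbf a\in\mathbb N^m,\,|\mathbf a|=i}\ \bigcup_j(\mathbf r-\mathbf a+e_j+\mathbb N^m)\Big\}.$$ Theorem. Let $V$ be a finitely generated $\mathscr{FI}^m$-module over $k$, let $i\ge 1$, and let $\mathbf c_i\in\mathbb Z^m$ be a vector such that $\mathbf c_i-\mathbf a\in\mathrm{CMreg}_+(V)$ for every $\mathbf a\in\mathbb N^m$ with $|\mathbf a|=i$. Then $\mathbf c_i\in\mathrm{HD}_i(V)$. -/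

import Mathlib

open CategoryTheory CategoryTheory.Limits

universe u

/-- The category `FI`: its objects are the finite sets `[n]`, `n ∈ ℕ`, and its morphisms are the
injections. The object `[n]` is recorded by its cardinality and realised as `Fin n`. -/
structure FI : Type where
  /-- the cardinality of the object -/
  card : ℕ

instance : Category.{0} FI where
  Hom a b := Fin a.card ↪ Fin b.card
  id a := Function.Embedding.refl (Fin a.card)
  comp f g := Function.Embedding.trans f g

/-- The underlying injection of a morphism of `FI`. -/
def FI.toEmb {a b : FI} (f : a ⟶ b) : Fin a.card ↪ Fin b.card := f

/-- The `m`-fold product category `FI^m`. -/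
abbrev FIProd (m : ℕ) : Type := Fin m → FI

/-- The object `[n] = [n_1] × ⋯ × [n_m]` of `FI^m`. -/
def FIProd.ofVec {m : ℕ} (n : Fin m → ℕ) : FIProd m := fun j => ⟨n j⟩

/-- A morphism `f_1 × ⋯ × f_m` of `FI^m` is non-invertible if some `f_j` is not a bijection; the
maps induced on an `FI^m`-module by such morphisms are the transition maps. -/
def IsTransition {m : ℕ} {a b : FIProd m} (f : a ⟶ b) : Prop :=
  ∃ j, ¬ Function.Bijective (FI.toEmb (f j))

/-- `FI^m`-modules over `k`: functors from `FI^m` to `k`-modules. -/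
abbrev FIMod (k : Type u) [CommRing k] (m : ℕ) : Type (u + 1) := FIProd m ⥤ ModuleCat.{u} k

/-! ### Combinatorics of injections -/

theorem FI.exists_factor {a b c : FI} (f : a ⟶ b) (g : a ⟶ c) (h : b.card ≤ c.card) :
    ∃ t : b ⟶ c, f ≫ t = g := by
  classical
  have e : Nonempty (((Set.range (FI.toEmb f))ᶜ : Set (Fin b.card)) ↪
      ((Set.range (FI.toEmb g))ᶜ : Set (Fin c.card))) := by
    apply Function.Embedding.nonempty_of_card_le
    rw [Fintype.card_compl_set, Fintype.card_compl_set,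
      Set.card_range_of_injective (FI.toEmb f).injective,
      Set.card_range_of_injective (FI.toEmb g).injective]
    simp only [Fintype.card_fin]
    omega
  obtain ⟨e⟩ := e
  let e1 : (Set.range (FI.toEmb f)) ≃ (Set.range (FI.toEmb g)) :=
    (Equiv.ofInjective _ (FI.toEmb f).injective).symm.trans
      (Equiv.ofInjective _ (FI.toEmb g).injective)
  let t : Fin b.card ↪ Fin c.card :=
    ((Equiv.Set.sumCompl (Set.range (FI.toEmb f))).symm.toEmbedding.trans
      (Function.Embedding.sumMap e1.toEmbedding e)).trans
      (Equiv.Set.sumCompl (Set.range (FI.toEmb g))).toEmbedding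
  refine ⟨t, ?_⟩
  apply Function.Embedding.ext
  intro x
  change t (FI.toEmb f x) = FI.toEmb g x
  have hx : (Equiv.Set.sumCompl (Set.range (FI.toEmb f))).symm (FI.toEmb f x) =
      Sum.inl ⟨FI.toEmb f x, x, rfl⟩ :=
    Equiv.Set.sumCompl_symm_apply_of_mem (Set.mem_range_self x)
  have h1 : (Equiv.ofInjective _ (FI.toEmb f).injective).symm ⟨FI.toEmb f x, x, rfl⟩ = x :=
    Equiv.ofInjective_symm_apply (FI.toEmb f).injective x
  simp only [t, Function.Embedding.trans_apply, Equiv.coe_toEmbedding, hx]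
  change (e1 ⟨FI.toEmb f x, x, rfl⟩ : Fin c.card) = _
  simp [e1, h1]

theorem FIProd.exists_factor {m : ℕ} {a b c : FIProd m} (f : a ⟶ b) (g : a ⟶ c)
    (h : ∀ j, (b j).card ≤ (c j).card) : ∃ t : b ⟶ c, f ≫ t = g := by
  choose t ht using fun j => FI.exists_factor (f j) (g j) (h j)
  exact ⟨t, funext ht⟩

theorem FI.card_le {a b : FI} (f : a ⟶ b) : a.card ≤ b.card := by
  simpa using Fintype.card_le_of_embedding (FI.toEmb f)

theorem FI.bijective_iff {a b : FI} (f : a ⟶ b) :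
    Function.Bijective (FI.toEmb f) ↔ a.card = b.card := by
  rw [Fintype.bijective_iff_injective_and_card]
  simp [(FI.toEmb f).injective]

theorem isTransition_iff {m : ℕ} {a b : FIProd m} (f : a ⟶ b) :
    IsTransition f ↔ ∃ j, (a j).card < (b j).card := by
  unfold IsTransition
  refine exists_congr fun j => ?_
  rw [FI.bijective_iff]
  have := FI.card_le (f j)
  omega

theorem IsTransition.comp {m : ℕ} {a b c : FIProd m} {f : a ⟶ b} (hf : IsTransition f)
    (g : b ⟶ c) : IsTransition (f ≫ g) := by
  rw [isTransition_iff] at hf ⊢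
  obtain ⟨j, hj⟩ := hf
  exact ⟨j, lt_of_lt_of_le hj (FI.card_le (g j))⟩

/-- A morphism out of `a` which is large in all directions. -/
theorem FIProd.exists_large {m : ℕ} [NeZero m] (a b c : FIProd m) :
    ∃ (d : FIProd m) (f : a ⟶ d), IsTransition f ∧ (∀ j, (b j).card ≤ (d j).card) ∧
      (∀ j, (c j).card ≤ (d j).card) := by
  let d : FIProd m := fun j => ⟨(a j).card + (b j).card + (c j).card + 1⟩
  let f : a ⟶ d := fun j => (Fin.castLEEmb (by simp only [d]; omega) :
    Fin (a j).card ↪ Fin (d j).card)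
  refine ⟨d, f, ?_, fun j => ?_, fun j => ?_⟩
  · rw [isTransition_iff]
    exact ⟨0, by simp only [d]; omega⟩
  · simp only [d]; omega
  · simp only [d]; omega

/-! ### Submodules and quotient modules of `FI^m`-modules -/

section Modules

variable {k : Type u} [CommRing k] {m : ℕ}

/-- A submodule of an `FI^m`-module: a family of `k`-submodules stable under all induced maps. -/
structure FISub (V : FIMod k m) where
  /-- the value at an object -/
  carrier : ∀ a : FIProd m, Submodule k (V.obj a)
  map_mem : ∀ {a b : FIProd m} (f : a ⟶ b) (v : V.obj a), v ∈ carrier a →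
    (V.map f).hom v ∈ carrier b

/-- A submodule, viewed as an `FI^m`-module. -/
def FISub.toMod {V : FIMod k m} (W : FISub V) : FIMod k m where
  obj a := ModuleCat.of k (W.carrier a)
  map f := ModuleCat.ofHom ((V.map f).hom.restrict (W.map_mem f))
  map_id a := by
    ext x
    exact congrArg (fun t => t.hom x.1) (V.map_id a)
  map_comp f g := by
    ext x
    exact congrArg (fun t => t.hom x.1) (V.map_comp f g)

/-- The quotient of an `FI^m`-module by a submodule. -/
def FISub.quot {V : FIMod k m} (W : FISub V) : FIMod k m where
  obj a := ModuleCat.of k (V.obj a ⧸ W.carrier a)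
  map {a b} f := ModuleCat.ofHom ((W.carrier a).mapQ (W.carrier b) (V.map f).hom (W.map_mem f))
  map_id a := by
    ext x
    simp
  map_comp f g := by
    ext x
    simp

/-- `V` is finitely generated: there are finitely many elements of `⊔_n V_n` which are not all
contained in any proper submodule. -/
def FIMod.IsFG (V : FIMod k m) : Prop :=
  ∃ s : Set (Σ a : FIProd m, V.obj a), s.Finite ∧
    ∀ W : FISub V, (∀ x ∈ s, x.2 ∈ W.carrier x.1) → ∀ a, W.carrier a = ⊤

/-! ### The functor `H_0` and `FI^m`-homology -/

/-- The submodule `V_{<n}` of `V_n` generated by the images of the transition maps into `V_n`. -/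
def FIMod.lt (V : FIMod k m) : FISub V where
  carrier b := Submodule.span k
    {v | ∃ (a : FIProd m) (f : a ⟶ b) (w : V.obj a), IsTransition f ∧ (V.map f).hom w = v}
  map_mem {a b} g v hv := by
    induction hv using Submodule.span_induction with
    | mem v h =>
      obtain ⟨c, f, w, hf, rfl⟩ := h
      exact Submodule.subset_span ⟨c, f ≫ g, w, hf.comp g, by simp⟩
    | zero => simp
    | add x y _ _ hx hy => rw [map_add]; exact add_mem hx hy
    | smul r x _ hx => rw [map_smul]; exact Submodule.smul_mem _ _ hx

theorem FIMod.lt_map {V W : FIMod k m} (φ : V ⟶ W) (a : FIProd m) :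
    (FIMod.lt V).carrier a ≤ ((FIMod.lt W).carrier a).comap (φ.app a).hom := by
  refine Submodule.span_le.2 ?_
  rintro _ ⟨c, f, w, hf, rfl⟩
  refine Submodule.subset_span ⟨c, f, (φ.app c).hom w, hf, ?_⟩
  exact (NatTrans.naturality_apply φ f w).symm

/-- The functor `V ↦ H_0(V)`, `H_0(V)_n = V_n / V_{<n}`. -/
def FIHomZero (k : Type u) [CommRing k] (m : ℕ) : FIMod k m ⥤ FIMod k m where
  obj V := (FIMod.lt V).quot
  map {V W} φ :=
    { app := fun a => ModuleCat.ofHom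
        (((FIMod.lt V).carrier a).mapQ ((FIMod.lt W).carrier a) (φ.app a).hom (FIMod.lt_map φ a))
      naturality := by
        intro a b f
        apply ModuleCat.hom_ext
        apply Submodule.linearMap_qext
        ext x
        have h := NatTrans.naturality_apply φ f x
        exact congrArg (Submodule.Quotient.mk (p := (FIMod.lt W).carrier b)) h }
  map_id V := by
    ext a : 2
    apply ModuleCat.hom_ext
    apply Submodule.linearMap_qext
    rfl
  map_comp φ ψ := by
    ext a : 2
    apply ModuleCat.hom_ext
    apply Submodule.linearMap_qext
    rfl

instance : (FIHomZero k m).Additive where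
  map_add := by
    intros
    ext a : 2
    apply ModuleCat.hom_ext
    apply Submodule.linearMap_qext
    rfl

/-! ### `B`-torsion -/

/-- An element of `V_n` is `B`-torsion if it is in the kernel of some transition map. -/
def FIMod.IsBTorsion (V : FIMod k m) {a : FIProd m} (v : V.obj a) : Prop :=
  ∃ (b : FIProd m) (f : a ⟶ b), IsTransition f ∧ (V.map f).hom v = 0

theorem FIMod.map_eq_zero_of_card_le (V : FIMod k m) {a b c : FIProd m} {v : V.obj a}
    (f : a ⟶ b) (hv : (V.map f).hom v = 0) (g : a ⟶ c) (h : ∀ j, (b j).card ≤ (c j).card) :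
    (V.map g).hom v = 0 := by
  obtain ⟨t, rfl⟩ := FIProd.exists_factor f g h
  simp [hv]

/-- The maximal `B`-torsion submodule `V_T`, consisting of all `B`-torsion elements. -/
def FIMod.torsion [NeZero m] (V : FIMod k m) : FISub V where
  carrier a :=
    { carrier := {v | V.IsBTorsion v}
      zero_mem' := by
        obtain ⟨d, f, hf, -⟩ := FIProd.exists_large a a a
        exact ⟨d, f, hf, map_zero _⟩
      add_mem' := by
        rintro x y ⟨b, f, -, hx⟩ ⟨c, g, -, hy⟩
        obtain ⟨d, t, ht, hb, hc⟩ := FIProd.exists_large a b c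
        refine ⟨d, t, ht, ?_⟩
        rw [map_add, V.map_eq_zero_of_card_le f hx t hb, V.map_eq_zero_of_card_le g hy t hc,
          add_zero]
      smul_mem' := by
        rintro r x ⟨b, f, hf, hx⟩
        exact ⟨b, f, hf, by rw [map_smul, hx, smul_zero]⟩ }
  map_mem {a b} g v hv := by
    obtain ⟨c, f, -, hv⟩ := hv
    obtain ⟨d, t, ht, hc, -⟩ := FIProd.exists_large b c c
    refine ⟨d, t, ht, ?_⟩
    have := V.map_eq_zero_of_card_le f hv (g ≫ t) hc
    simpa using this

theorem FIMod.torsion_map [NeZero m] {V W : FIMod k m} (φ : V ⟶ W) (a : FIProd m) (v : V.obj a)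
    (hv : v ∈ (FIMod.torsion V).carrier a) :
    (φ.app a).hom v ∈ (FIMod.torsion W).carrier a := by
  obtain ⟨b, f, hf, hv⟩ := hv
  refine ⟨b, f, hf, ?_⟩
  have h := NatTrans.naturality_apply φ f v
  exact h.symm.trans ((congrArg (φ.app b).hom hv).trans (map_zero _))

/-- The `B`-torsion functor `V ↦ H^0_B(V) = V_T`. -/
def BTorsionFunctor (k : Type u) [CommRing k] (m : ℕ) [NeZero m] : FIMod k m ⥤ FIMod k m where
  obj V := (FIMod.torsion V).toMod
  map {V W} φ :=
    { app := fun a => ModuleCat.ofHom ((φ.app a).hom.restrict (FIMod.torsion_map φ a))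
      naturality := by
        intro a b f
        apply ModuleCat.hom_ext
        refine LinearMap.ext fun x => Subtype.ext ?_
        exact NatTrans.naturality_apply φ f x.1 }
  map_id V := rfl
  map_comp φ ψ := rfl

instance [NeZero m] : (BTorsionFunctor k m).Additive where
  map_add := rfl

/-! ### Enough projectives and injectives -/

instance : EnoughProjectives (FIMod k m) where
  presentation V := by
    let P : FIProd m → FIMod k m := fun a =>
      (evaluationLeftAdjoint (ModuleCat.{u} k) a).obj (Projective.over (V.obj a))
    have hP : ∀ a, Projective (P a) := fun a =>
      (evaluationAdjunctionRight (ModuleCat.{u} k) a).map_projective _ inferInstance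
    let q : ∀ a, P a ⟶ V := fun a =>
      ((evaluationAdjunctionRight (ModuleCat.{u} k) a).homEquiv _ V).symm (Projective.π (V.obj a))
    have hS : Projective (∐ P) :=
      ⟨fun {_ _} f e _ => ⟨Sigma.desc fun b => Projective.factorThru (Sigma.ι P b ≫ f) e, by
        refine Sigma.hom_ext _ _ fun b => ?_
        rw [Sigma.ι_desc_assoc, Projective.factorThru_comp]⟩⟩
    refine ⟨{ p := ∐ P, projective := hS, f := Sigma.desc q, epi := ?_ }⟩
    have : ∀ a, Epi ((Sigma.desc q).app a) := by
      intro a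
      have h1 : (Projective.π (V.obj a)) =
          (evaluationAdjunctionRight (ModuleCat.{u} k) a).unit.app _ ≫
            ((Sigma.ι P a).app a ≫ (Sigma.desc q).app a) := by
        rw [← NatTrans.comp_app, Sigma.ι_desc]
        have := ((evaluationAdjunctionRight (ModuleCat.{u} k) a).homEquiv _ V).apply_symm_apply
          (Projective.π (V.obj a))
        rw [Adjunction.homEquiv_unit] at this
        exact this.symm
      have h2 : Epi (((evaluationAdjunctionRight (ModuleCat.{u} k) a).unit.app _ ≫
            (Sigma.ι P a).app a) ≫ (Sigma.desc q).app a) := by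
        rw [Category.assoc, ← h1]
        infer_instance
      exact epi_of_epi ((evaluationAdjunctionRight (ModuleCat.{u} k) a).unit.app _ ≫
        (Sigma.ι P a).app a) ((Sigma.desc q).app a)
    exact NatTrans.epi_of_epi_app _

instance : EnoughInjectives (FIMod k m) where
  presentation V := by
    let J : FIProd m → FIMod k m := fun a =>
      (evaluationRightAdjoint (ModuleCat.{u} k) a).obj (Injective.under (V.obj a))
    have hJ : ∀ a, Injective (J a) := fun a =>
      Injective.injective_of_adjoint (evaluationAdjunctionLeft (ModuleCat.{u} k) a) _
    let q : ∀ a, V ⟶ J a := fun a =>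
      (evaluationAdjunctionLeft (ModuleCat.{u} k) a).homEquiv V _ (Injective.ι (V.obj a))
    refine ⟨{ J := ∏ᶜ J, injective := inferInstance, f := Pi.lift q, mono := ?_ }⟩
    have : ∀ a, Mono ((Pi.lift q).app a) := by
      intro a
      have h1 : (Injective.ι (V.obj a)) =
          (Pi.lift q).app a ≫ ((Pi.π J a).app a ≫
            (evaluationAdjunctionLeft (ModuleCat.{u} k) a).counit.app _) := by
        rw [← Category.assoc, ← NatTrans.comp_app, Pi.lift_π]
        have := ((evaluationAdjunctionLeft (ModuleCat.{u} k) a).homEquiv V _).symm_apply_apply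
          (Injective.ι (V.obj a))
        rw [Adjunction.homEquiv_counit] at this
        exact this.symm
      have h2 : Mono ((Pi.lift q).app a ≫ ((Pi.π J a).app a ≫
            (evaluationAdjunctionLeft (ModuleCat.{u} k) a).counit.app _)) := by
        rw [← h1]
        infer_instance
      exact mono_of_mono ((Pi.lift q).app a) ((Pi.π J a).app a ≫
        (evaluationAdjunctionLeft (ModuleCat.{u} k) a).counit.app _)
    exact NatTrans.mono_of_mono_app _

/-! ### Homology, local cohomology and the associated regions of `ℤ^m` -/

/-- The `FI^m`-homology functors `H_i`: the left derived functors of `H_0`. -/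
noncomputable def FIHomology (i : ℕ) (V : FIMod k m) : FIMod k m :=
  ((FIHomZero k m).leftDerived i).obj V

/-- The local cohomology functors `H^i_B`: the right derived functors of the `B`-torsion
functor. -/
noncomputable def FILocalCohomology [NeZero m] (i : ℕ) (V : FIMod k m) : FIMod k m :=
  ((BTorsionFunctor k m).rightDerived i).obj V

/-- `V_n = 0`, for `n ∈ ℤ^m`, with the convention `V_n = 0` for `n ∉ ℕ^m`. -/
def FIMod.VanishesAt (V : FIMod k m) (n : Fin m → ℤ) : Prop :=
  ∀ p : Fin m → ℕ, (∀ j, (p j : ℤ) = n j) → Subsingleton (V.obj (FIProd.ofVec p))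

/-- The region `⋃_j (r + e_j + ℕ^m)` of vectors at least one positive step from `r`. -/
def positiveStep {m : ℕ} (r : Fin m → ℤ) : Set (Fin m → ℤ) :=
  {n | ∃ (j : Fin m) (p : Fin m → ℕ), n = r + Pi.single j 1 + fun l => (p l : ℤ)}

/-- The `i`-th homological degree `HD_i(V) ⊆ ℤ^m`. -/
def HD (i : ℕ) (V : FIMod k m) : Set (Fin m → ℤ) :=
  {r | ∀ n ∈ positiveStep r, (FIHomology i V).VanishesAt n}

/-- The positive Castelnuovo–Mumford regularity `CMreg_+(V) ⊆ ℤ^m`. -/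
def CMregPos [NeZero m] (V : FIMod k m) : Set (Fin m → ℤ) :=
  {r | ∀ (i : ℕ) (a : Fin m → ℕ), ∑ j, a j = i →
    ∀ n ∈ positiveStep (r - fun l => (a l : ℤ)), (FILocalCohomology i V).VanishesAt n}

end Modules

/-! ### Signs and the chain complex of a simplex -/

section Chains

/-! Fix `n`. The Koszul complex of `V` in degree `n` has, in homological degree `p`, the sum of the
modules `V(A)` over all subsets `A` of codimension `p` in the disjoint union of the sets `[n_j]`;
its differential is the signed sum of the inclusion maps. It links homology, computed by projective
resolutions, with local cohomology, computed by injective ones.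

Projective side. For a free module, split a chain by the basis elements `f` of the value at the full
set. The coefficient of `f` lives on the sets `A` containing the image of `f`. These sets form a
cube, which is contractible unless `f` is surjective, and then only degree 0 is left. So Koszul
complexes of projectives are acyclic in positive degrees (`koszul_exact_of_projective`), while the
cokernel at the full set is `H_0`. A double complex chase (`koszul_chase_left`) shows that `H_i(V)_n
= 0` once the Koszul complex of `V` is exact in degree `i`.

Injective side. For an injective module the Koszul complex is acyclic in positive degrees modulo
torsion (`koszul_exact_of_injective`). Indeed Koszul chains are maps out of a free module
`koszulFree`, whose value at `b` is spanned by partial injections into `b`, that is, by placements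
of non-attacking rooks. Its boundary is the simplicial one, and on a large board every cycle below
top dimension bounds (`chessboard_exact`); injectivity dualises this. A second chase
(`koszul_chase_right`) compares an injective resolution with its torsion subcomplex, whose
cohomology is `H^q_B(V)`. It gives exactness in degree `i` if `H^q_B(V)` vanishes at every `A` of
codimension `i + q`, for all `q`.

Numerics. The codimension vector of such an `A` has sum `i + q`, so it is `a + a'` with `|a| = i`
and `|a'| = q`. If `n` lies in `c + e_j + ℕ^m`, then `A` has degree `n - a - a'`, where vanishing is
part of `c - a ∈ CMregPos V`. -/

theorem map_mem_supported {k α β : Type*} [CommRing k] {S : Set α} {T : Set β}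
    {φ : (α →₀ k) →ₗ[k] (β →₀ k)}
    (h : ∀ σ ∈ S, φ (Finsupp.single σ 1) ∈ Finsupp.supported k k T) {z : α →₀ k}
    (hz : z ∈ Finsupp.supported k k S) : φ z ∈ Finsupp.supported k k T := by
  rw [Finsupp.supported_eq_span_single] at hz
  induction hz using Submodule.span_induction with
  | mem x hx => obtain ⟨σ, hσ, rfl⟩ := hx; exact h σ hσ
  | zero => simp
  | add x y _ _ hx hy => rw [map_add]; exact add_mem hx hy
  | smul r x _ hx => rw [map_smul]; exact Submodule.smul_mem _ _ hx

variable {W O : Type*} [LinearOrder O]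

/-- The sign with which `s` is removed from, or added to form, the finite set `B`, with respect to
the ordering given by a rank function `e`. -/
def rankSign (e : W → O) (s : W) (B : Finset W) : ℤ := (-1) ^ (B.filter fun t => e t < e s).card

theorem rankSign_mul_self (e : W → O) (s : W) (B : Finset W) :
    rankSign e s B * rankSign e s B = 1 := by
  unfold rankSign
  rw [← mul_pow]
  simp

variable [DecidableEq W]

/-- If `s` precedes `t`, deleting `s` lowers the rank of `t` by one, while deleting `t` does not
affect the rank of `s`. This sign is the reason why the differentials below square to zero. -/
theorem rankSign_erase {e : W → O} (he : Function.Injective e) {s t : W} {B : Finset W}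
    (hs : s ∈ B) (ht : t ∈ B) (hst : s ≠ t) :
    rankSign e s B * rankSign e t (B.erase s) = -(rankSign e t B * rankSign e s (B.erase t)) := by
  wlog h : e s < e t generalizing s t
  · have h' : e t < e s := lt_of_le_of_ne (not_lt.1 h) fun hh => hst (he hh).symm
    rw [this ht hs hst.symm h', neg_neg]
  have h1 : (B.erase s).filter (fun a => e a < e t) = (B.filter fun a => e a < e t).erase s :=
    Finset.filter_erase _ _ _
  have h2 : (B.erase t).filter (fun a => e a < e s) = B.filter fun a => e a < e s := by
    ext a
    simp only [Finset.mem_filter, Finset.mem_erase]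
    exact ⟨fun ⟨⟨_, b⟩, c⟩ => ⟨b, c⟩, fun ⟨b, c⟩ => ⟨⟨by rintro rfl; exact lt_asymm c h, b⟩, c⟩⟩
  have hmem : s ∈ B.filter fun a => e a < e t := by simp [hs, h]
  unfold rankSign
  rw [h1, h2, ← Finset.card_erase_add_one hmem]
  ring

variable (k : Type*) [CommRing k]

/-- Contraction of chains with a vertex. -/
noncomputable def contractVertex (e : W → O) (v : W) : (Finset W →₀ k) →ₗ[k] (Finset W →₀ k) :=
  Finsupp.linearCombination k fun σ =>
    if v ∈ σ then rankSign e v σ • Finsupp.single (σ.erase v) (1 : k) else 0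

/-- The cone over chains with a given apex. -/
noncomputable def coneVertex (e : W → O) (v : W) : (Finset W →₀ k) →ₗ[k] (Finset W →₀ k) :=
  Finsupp.linearCombination k fun σ =>
    if v ∈ σ then 0 else rankSign e v (insert v σ) • Finsupp.single (insert v σ) (1 : k)

/-- The boundary map of the (augmented) chain complex of the simplex with vertex set `W`. -/
noncomputable def simplexBoundary [Fintype W] (e : W → O) :
    (Finset W →₀ k) →ₗ[k] (Finset W →₀ k) :=
  ∑ v, contractVertex k e v

variable {k}

theorem contractVertex_single_of_mem {e : W → O} {v : W} {σ : Finset W} (h : v ∈ σ) :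
    contractVertex k e v (Finsupp.single σ 1) =
      rankSign e v σ • Finsupp.single (σ.erase v) (1 : k) := by
  simp [contractVertex, h]

theorem contractVertex_single_of_notMem {e : W → O} {v : W} {σ : Finset W} (h : v ∉ σ) :
    contractVertex k e v (Finsupp.single σ 1) = 0 := by
  simp [contractVertex, h]

theorem coneVertex_single_of_mem {e : W → O} {v : W} {σ : Finset W} (h : v ∈ σ) :
    coneVertex k e v (Finsupp.single σ 1) = 0 := by
  simp [coneVertex, h]

theorem coneVertex_single_of_notMem {e : W → O} {v : W} {σ : Finset W} (h : v ∉ σ) :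
    coneVertex k e v (Finsupp.single σ 1) =
      rankSign e v (insert v σ) • Finsupp.single (insert v σ) (1 : k) := by
  simp [coneVertex, h]

theorem cone_contract_single (e : W → O) (v : W) (σ : Finset W) :
    coneVertex k e v (contractVertex k e v (Finsupp.single σ 1)) =
      if v ∈ σ then Finsupp.single σ (1 : k) else 0 := by
  split_ifs with h
  · rw [contractVertex_single_of_mem h, map_zsmul, coneVertex_single_of_notMem (by simp),
      Finset.insert_erase h, smul_smul, rankSign_mul_self, one_smul]
  · rw [contractVertex_single_of_notMem h, map_zero]

theorem contract_cone_single (e : W → O) (v : W) (σ : Finset W) :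
    contractVertex k e v (coneVertex k e v (Finsupp.single σ 1)) =
      if v ∈ σ then 0 else Finsupp.single σ (1 : k) := by
  split_ifs with h
  · rw [coneVertex_single_of_mem h, map_zero]
  · rw [coneVertex_single_of_notMem h, map_zsmul, contractVertex_single_of_mem (by simp),
      Finset.erase_insert h, smul_smul, rankSign_mul_self, one_smul]

theorem contract_contract_self (e : W → O) (v : W) (z : Finset W →₀ k) :
    contractVertex k e v (contractVertex k e v z) = 0 := by
  suffices h : contractVertex k e v ∘ₗ contractVertex k e v = 0 from LinearMap.congr_fun h z
  refine Finsupp.lhom_ext' fun σ => LinearMap.ext_ring ?_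
  simp only [LinearMap.comp_apply, Finsupp.lsingle_apply, LinearMap.zero_apply]
  by_cases h : v ∈ σ
  · rw [contractVertex_single_of_mem h, map_zsmul, contractVertex_single_of_notMem (by simp),
      smul_zero]
  · rw [contractVertex_single_of_notMem h, map_zero]

theorem contract_contract {e : W → O} (he : Function.Injective e) {v w : W} (hvw : v ≠ w)
    (z : Finset W →₀ k) :
    contractVertex k e v (contractVertex k e w z) =
      -contractVertex k e w (contractVertex k e v z) := by
  suffices h : contractVertex k e v ∘ₗ contractVertex k e w =
      -(contractVertex k e w ∘ₗ contractVertex k e v) from LinearMap.congr_fun h z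
  refine Finsupp.lhom_ext' fun σ => LinearMap.ext_ring ?_
  simp only [LinearMap.comp_apply, Finsupp.lsingle_apply, LinearMap.neg_apply]
  by_cases hv : v ∈ σ <;> by_cases hw : w ∈ σ
  · have hv' : v ∈ σ.erase w := Finset.mem_erase.2 ⟨hvw, hv⟩
    have hw' : w ∈ σ.erase v := Finset.mem_erase.2 ⟨hvw.symm, hw⟩
    rw [contractVertex_single_of_mem hv, contractVertex_single_of_mem hw, map_zsmul, map_zsmul,
      contractVertex_single_of_mem hv', contractVertex_single_of_mem hw', smul_smul, smul_smul,
      rankSign_erase he hw hv hvw.symm, neg_smul, Finset.erase_right_comm]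
  · rw [contractVertex_single_of_mem hv, contractVertex_single_of_notMem hw, map_zsmul,
      contractVertex_single_of_notMem (fun h => hw (Finset.mem_of_mem_erase h))]
    simp
  · rw [contractVertex_single_of_mem hw, contractVertex_single_of_notMem hv, map_zsmul,
      contractVertex_single_of_notMem (fun h => hv (Finset.mem_of_mem_erase h))]
    simp
  · rw [contractVertex_single_of_notMem hv, contractVertex_single_of_notMem hw]
    simp

theorem contract_cone {e : W → O} (he : Function.Injective e) {v w : W} (hvw : v ≠ w)
    (z : Finset W →₀ k) :
    contractVertex k e v (coneVertex k e w z) = -coneVertex k e w (contractVertex k e v z) := by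
  suffices h : contractVertex k e v ∘ₗ coneVertex k e w =
      -(coneVertex k e w ∘ₗ contractVertex k e v) from LinearMap.congr_fun h z
  refine Finsupp.lhom_ext' fun σ => LinearMap.ext_ring ?_
  simp only [LinearMap.comp_apply, Finsupp.lsingle_apply, LinearMap.neg_apply]
  by_cases hv : v ∈ σ <;> by_cases hw : w ∈ σ
  · rw [contractVertex_single_of_mem hv, coneVertex_single_of_mem hw, map_zsmul,
      coneVertex_single_of_mem (Finset.mem_erase.2 ⟨hvw.symm, hw⟩)]
    simp
  · have hv' : v ∈ insert w σ := Finset.mem_insert_of_mem hv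
    have hw' : w ∉ σ.erase v := fun h => hw (Finset.mem_of_mem_erase h)
    have e1 : insert w (σ.erase v) = (insert w σ).erase v := by
      rw [Finset.erase_insert_of_ne hvw.symm]
    have key := rankSign_erase he hv' (Finset.mem_insert_self w σ) hvw
    rw [Finset.erase_insert hw] at key
    rw [contractVertex_single_of_mem hv, coneVertex_single_of_notMem hw, map_zsmul, map_zsmul,
      contractVertex_single_of_mem hv', coneVertex_single_of_notMem hw', e1, smul_smul, smul_smul,
      ← neg_smul]
    congr 1
    have a1 := rankSign_mul_self e w (insert w σ)
    have a3 := rankSign_mul_self e w ((insert w σ).erase v)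
    linear_combination (rankSign e v σ * rankSign e w ((insert w σ).erase v)) * (-a1) +
      rankSign e w (insert w σ) * rankSign e w ((insert w σ).erase v) * key -
      rankSign e w (insert w σ) * rankSign e v (insert w σ) * (a3)
  · rw [coneVertex_single_of_mem hw, contractVertex_single_of_notMem hv]
    simp
  · rw [contractVertex_single_of_notMem hv, coneVertex_single_of_notMem hw, map_zsmul,
      contractVertex_single_of_notMem (by simp [hvw, hv])]
    simp

variable [Fintype W]

theorem boundary_contract {e : W → O} (he : Function.Injective e) (v : W) (z : Finset W →₀ k) :
    simplexBoundary k e (contractVertex k e v z) =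
      -contractVertex k e v (simplexBoundary k e z) := by
  simp only [simplexBoundary, LinearMap.sum_apply, map_sum, ← Finset.sum_neg_distrib]
  refine Finset.sum_congr rfl fun w _ => ?_
  by_cases h : w = v
  · subst h
    rw [contract_contract_self, neg_zero]
  · exact contract_contract he h z

/-- The cone is a contracting homotopy of the full simplex: contraction with any vertex other than
the apex anticommutes with it, and contraction with the apex contributes the term `z`. -/
theorem boundary_cone {e : W → O} (he : Function.Injective e) (v : W) (z : Finset W →₀ k) :
    simplexBoundary k e (coneVertex k e v z) = z - coneVertex k e v (simplexBoundary k e z) := by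
  have hself : ∀ z : Finset W →₀ k, contractVertex k e v (coneVertex k e v z) =
      z - coneVertex k e v (contractVertex k e v z) := by
    intro z
    suffices h : contractVertex k e v ∘ₗ coneVertex k e v =
      LinearMap.id - (coneVertex k e v ∘ₗ contractVertex k e v) from LinearMap.congr_fun h z
    refine Finsupp.lhom_ext' fun σ => LinearMap.ext_ring ?_
    simp only [LinearMap.comp_apply, Finsupp.lsingle_apply, LinearMap.sub_apply, LinearMap.id_apply]
    rw [cone_contract_single, contract_cone_single]
    split_ifs <;> simp
  simp only [simplexBoundary, LinearMap.sum_apply, map_sum]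
  rw [← Finset.add_sum_erase _ _ (Finset.mem_univ v), ← Finset.add_sum_erase Finset.univ
    (fun w => coneVertex k e v (contractVertex k e w z)) (Finset.mem_univ v), hself,
    Finset.sum_congr rfl fun w hw => contract_cone he (Finset.ne_of_mem_erase hw) z,
    Finset.sum_neg_distrib]
  abel

theorem boundary_boundary {e : W → O} (he : Function.Injective e) (z : Finset W →₀ k) :
    simplexBoundary k e (simplexBoundary k e z) = 0 := by
  simp only [simplexBoundary, LinearMap.sum_apply, map_sum]
  rw [← Finset.sum_product']
  refine Finset.sum_involution (fun p _ => (p.2, p.1)) ?_ ?_ ?_ ?_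
  · rintro ⟨v, w⟩ -
    by_cases h : v = w
    · subst h
      simp [contract_contract_self]
    · simp [contract_contract he h]
  · rintro ⟨v, w⟩ - h1 h2
    simp only [Prod.mk.injEq] at h2
    rw [h2.1] at h1
    exact h1 (contract_contract_self e v z)
  · simp
  · simp

end Chains

/-! ### Acyclicity of chessboard complexes -/

section Chessboard

variable {W O k : Type*} [DecidableEq W] [LinearOrder O] [CommRing k]

/-- A simplex of `S` meets `V` in at most one vertex, so contracting and coning back over all of `V`
reproduces exactly the simplices that meet `V`, each once. -/
theorem sub_sum_cone_contract_mem {e : W → O} {S : Set (Finset W)} {V : Finset W}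
    (hV : ∀ σ ∈ S, ∀ v ∈ V, ∀ w ∈ V, v ∈ σ → w ∈ σ → v = w) {z : Finset W →₀ k}
    (hz : z ∈ Finsupp.supported k k S) :
    z - ∑ v ∈ V, coneVertex k e v (contractVertex k e v z) ∈
      Finsupp.supported k k {σ ∈ S | Disjoint V σ} := by
  have := map_mem_supported (T := {σ ∈ S | Disjoint V σ})
    (φ := LinearMap.id - ∑ v ∈ V, coneVertex k e v ∘ₗ contractVertex k e v) ?_ hz
  · simpa using this
  intro σ hσ
  simp only [LinearMap.sub_apply, LinearMap.id_apply, LinearMap.sum_apply, LinearMap.comp_apply,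
    cone_contract_single]
  by_cases h : Disjoint V σ
  · rw [Finset.sum_eq_zero, sub_zero]
    · exact Finsupp.single_mem_supported k _ ⟨hσ, h⟩
    · intro v hv
      rw [if_neg (Finset.disjoint_left.1 h hv)]
  · obtain ⟨v, hv, hvσ⟩ := Finset.not_disjoint_iff.1 h
    rw [Finset.sum_eq_single_of_mem v hv, if_pos hvσ, sub_self]
    · exact zero_mem _
    · intro w hw hwv
      rw [if_neg fun hwσ => hwv (hV σ hσ w hw v hv hwσ hvσ)]

/-- A cycle whose contractions with the pairwise incompatible vertices in `V` bound can be moved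
off `V`. -/
theorem exists_boundary_move [Fintype W] {e : W → O} (he : Function.Injective e)
    {S D T : Set (Finset W)} {V : Finset W} {L : W → Set (Finset W)}
    (hV : ∀ σ ∈ S, ∀ v ∈ V, ∀ w ∈ V, v ∈ σ → w ∈ σ → v = w)
    (hL : ∀ v ∈ V, ∀ σ ∈ L v, insert v σ ∈ D) (hLT : ∀ v ∈ V, L v ⊆ T)
    (hST : ∀ σ ∈ S, Disjoint V σ → σ ∈ T)
    {z : Finset W →₀ k} (hz : z ∈ Finsupp.supported k k S)
    (hex : ∀ v ∈ V, ∃ w ∈ Finsupp.supported k k (L v),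
      simplexBoundary k e w = contractVertex k e v z) :
    ∃ w ∈ Finsupp.supported k k D, z - simplexBoundary k e w ∈ Finsupp.supported k k T := by
  choose! w hw hwz using hex
  -- By `boundary_cone`, the boundary of the cone over `w v` is `w v` minus the part of `z` through
  -- `v`. Adding these boundaries trades that part for `w v`, which lies in `T`.
  refine ⟨-∑ v ∈ V, coneVertex k e v (w v), ?_, ?_⟩
  · refine neg_mem (sum_mem fun v hv => map_mem_supported (fun σ hσ => ?_) (hw v hv))
    by_cases hvσ : v ∈ σ
    · rw [coneVertex_single_of_mem hvσ]
      exact zero_mem _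
    · rw [coneVertex_single_of_notMem hvσ]
      exact zsmul_mem (Finsupp.single_mem_supported k _ (hL v hv σ hσ)) _
  · have : z - simplexBoundary k e (-∑ v ∈ V, coneVertex k e v (w v)) =
        (z - ∑ v ∈ V, coneVertex k e v (contractVertex k e v z)) + ∑ v ∈ V, w v := by
      rw [map_neg, map_sum, Finset.sum_congr rfl fun v hv => boundary_cone he v (w v),
        Finset.sum_sub_distrib, ← Finset.sum_congr rfl fun v hv =>
          congrArg (coneVertex k e v) (hwz v hv)]
      abel
    rw [this]
    refine add_mem (Finsupp.supported_mono ?_ (sub_sum_cone_contract_mem hV hz))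
      (sum_mem fun v hv => Finsupp.supported_mono (hLT v hv) (hw v hv))
    exact fun σ hσ => hST σ hσ.1 hσ.2

variable {X Y : Type*}

/-- Placements of non-attacking rooks in the rows `R` and the columns `C`, on the fields allowed by
the relation `r`. -/
def rookPlacements (r : X → Y → Prop) (R : Finset X) (C : Finset Y) : Set (Finset (X × Y)) :=
  {σ | (∀ v ∈ σ, v.1 ∈ R ∧ v.2 ∈ C ∧ r v.1 v.2) ∧
    ∀ v ∈ σ, ∀ w ∈ σ, (v.1 = w.1 ∨ v.2 = w.2) → v = w}

variable {r : X → Y → Prop}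

theorem card_le_of_mem_rookPlacements {R : Finset X} {C : Finset Y} {σ : Finset (X × Y)}
    (h : σ ∈ rookPlacements r R C) : σ.card ≤ R.card :=
  Finset.card_le_card_of_injOn Prod.fst (fun v hv => (h.1 v hv).1)
    fun v hv w hw hvw => h.2 v hv w hw (Or.inl hvw)

theorem rookPlacements_mono {R R' : Finset X} {C C' : Finset Y} (hR : R ⊆ R') (hC : C ⊆ C') :
    rookPlacements r R C ⊆ rookPlacements r R' C' :=
  fun _ h => ⟨fun v hv => ⟨hR (h.1 v hv).1, hC (h.1 v hv).2.1, (h.1 v hv).2.2⟩, h.2⟩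

variable [DecidableEq X] [DecidableEq Y]

theorem erase_mem_rookPlacements {R : Finset X} {C : Finset Y} {σ : Finset (X × Y)}
    (h : σ ∈ rookPlacements r R C) {v : X × Y} (hv : v ∈ σ) :
    σ.erase v ∈ rookPlacements r (R.erase v.1) (C.erase v.2) := by
  refine ⟨fun w hw => ?_, fun w hw w' hw' =>
    h.2 w (Finset.mem_of_mem_erase hw) w' (Finset.mem_of_mem_erase hw')⟩
  have hwσ := Finset.mem_of_mem_erase hw
  have hne := Finset.ne_of_mem_erase hw
  refine ⟨Finset.mem_erase.2 ⟨fun hh => hne (h.2 w hwσ v hv (Or.inl hh)), (h.1 w hwσ).1⟩,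
    Finset.mem_erase.2 ⟨fun hh => hne (h.2 w hwσ v hv (Or.inr hh)), (h.1 w hwσ).2.1⟩,
    (h.1 w hwσ).2.2⟩

theorem insert_mem_rookPlacements {R : Finset X} {C : Finset Y} {σ : Finset (X × Y)} {v : X × Y}
    (h : σ ∈ rookPlacements r (R.erase v.1) (C.erase v.2)) (h1 : v.1 ∈ R) (h2 : v.2 ∈ C)
    (hr : r v.1 v.2) : insert v σ ∈ rookPlacements r R C := by
  have hne : ∀ w ∈ σ, ¬ (v.1 = w.1 ∨ v.2 = w.2) := by
    rintro w hw (hh | hh)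
    · exact Finset.ne_of_mem_erase (h.1 w hw).1 hh.symm
    · exact Finset.ne_of_mem_erase (h.1 w hw).2.1 hh.symm
  refine ⟨fun w hw => ?_, fun w hw w' hw' hh => ?_⟩
  · rcases Finset.mem_insert.1 hw with rfl | hw
    · exact ⟨h1, h2, hr⟩
    · exact rookPlacements_mono (Finset.erase_subset _ _) (Finset.erase_subset _ _) h |>.1 w hw
  · rcases Finset.mem_insert.1 hw with h1 | h1 <;> rcases Finset.mem_insert.1 hw' with h2 | h2
    · rw [h1, h2]
    · exact absurd (h1 ▸ hh) (hne w' h2)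
    · exact absurd (h2 ▸ hh.imp Eq.symm Eq.symm) (hne w h1)
    · exact h.2 w h1 w' h2 hh

theorem contract_mem_rookPlacements {e : X × Y → O} {R : Finset X} {C : Finset Y}
    {z : Finset (X × Y) →₀ k}
    (hz : z ∈ Finsupp.supported k k {σ ∈ rookPlacements r R C | σ.card < R.card}) (v : X × Y) :
    contractVertex k e v z ∈ Finsupp.supported k k
      {σ ∈ rookPlacements r (R.erase v.1) (C.erase v.2) | σ.card < (R.erase v.1).card} := by
  refine map_mem_supported (fun σ hσ => ?_) hz
  by_cases hv : v ∈ σ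
  · rw [contractVertex_single_of_mem hv]
    have h1 := Finset.card_erase_add_one hv
    have h2 := Finset.card_erase_add_one (hσ.1.1 v hv).1
    have h3 := hσ.2
    have hmem : σ.erase v ∈ {σ ∈ rookPlacements r (R.erase v.1) (C.erase v.2) |
        σ.card < (R.erase v.1).card} :=
      ⟨erase_mem_rookPlacements hσ.1 hv, by omega⟩
    exact zsmul_mem (Finsupp.single_mem_supported k _ hmem) _
  · rw [contractVertex_single_of_notMem hv]
    exact zero_mem _

/-- Fix an allowed field `(x, y)`. Modulo boundaries a cycle can be moved off column `y` and then
off row `x`; what is left is compatible with a rook on `(x, y)` and is coned off from there. The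
moves need fillings in links, which are boards with one row fewer that have lost one column in the
first move and two in the second; hence the factor 2 in the hypothesis. The cardinality bound
excludes top-dimensional cycles, which need not bound. The empty placement counts as a simplex. -/
theorem chessboard_exact [Fintype X] [Fintype Y] [∀ x, DecidablePred (r x)] {e : X × Y → O}
    (he : Function.Injective e) (N : ℕ) : ∀ (R : Finset X) (C : Finset Y), R.card = N →
    (∀ x ∈ R, 2 * N ≤ (C.filter (r x)).card) → ∀ z : Finset (X × Y) →₀ k,
    z ∈ Finsupp.supported k k {σ ∈ rookPlacements r R C | σ.card < R.card} →
    simplexBoundary k e z = 0 →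
    ∃ w ∈ Finsupp.supported k k (rookPlacements r R C), simplexBoundary k e w = z := by
  induction N with
  | zero =>
    intro R C hR _ z hz _
    refine ⟨0, zero_mem _, ?_⟩
    have : {σ ∈ rookPlacements r R C | σ.card < R.card} = ∅ := by
      ext σ
      simp [hR]
    rw [this, Finsupp.supported_empty, Submodule.mem_bot] at hz
    rw [hz, map_zero]
  | succ N ih =>
    intro R C hR hC z hz hdz
    obtain ⟨x, hx⟩ : R.Nonempty := Finset.card_pos.1 (by omega)
    obtain ⟨y, hy⟩ : (C.filter (r x)).Nonempty := Finset.card_pos.1 (by have := hC x hx; omega)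
    obtain ⟨hyC, hxy⟩ := Finset.mem_filter.1 hy
    have hcol : ∀ (C : Finset Y) (y : Y) (x : X),
        (C.filter (r x)).card ≤ ((C.erase y).filter (r x)).card + 1 := fun C y x => by
      rw [Finset.filter_erase]
      exact Nat.sub_le_iff_le_add.1 Finset.pred_card_le_card_erase
    -- The excess of 1 over `2 * N` pays for the column of `v`, which is missing in the link. It is
    -- still there after column `y` has been removed.
    have hlink : ∀ (C : Finset Y) (v : X × Y) (z : Finset (X × Y) →₀ k), v.1 ∈ R →
        (∀ x ∈ R, 2 * N + 1 ≤ (C.filter (r x)).card) →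
        z ∈ Finsupp.supported k k {σ ∈ rookPlacements r R C | σ.card < R.card} →
        simplexBoundary k e z = 0 →
        ∃ w ∈ Finsupp.supported k k (rookPlacements r (R.erase v.1) (C.erase v.2)),
          simplexBoundary k e w = contractVertex k e v z := by
      intro C v z hv hC hz hdz
      refine ih _ _ (by rw [Finset.card_erase_of_mem hv, hR]; rfl) (fun x' hx' => ?_) _
        (contract_mem_rookPlacements hz v) (by rw [boundary_contract he, hdz, map_zero, neg_zero])
      have h1 := hC x' (Finset.mem_of_mem_erase hx')
      have h2 := hcol C v.2 x'
      omega
    -- clear the column `y`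
    obtain ⟨w₁, hw₁, hz₁⟩ := exists_boundary_move he
      (S := {σ ∈ rookPlacements r R C | σ.card < R.card})
      (D := rookPlacements r R C)
      (T := {σ ∈ rookPlacements r R (C.erase y) | σ.card < R.card})
      (V := (R.product {y}).filter fun v => r v.1 v.2)
      (L := fun v => rookPlacements r (R.erase v.1) (C.erase v.2)) (z := z)
      (by
        intro σ hσ v hv w hw hvσ hwσ
        simp only [Finset.product_eq_sprod, Finset.mem_filter, Finset.mem_product,
          Finset.mem_singleton] at hv hw
        exact hσ.1.2 v hvσ w hwσ (Or.inr (hv.1.2.trans hw.1.2.symm)))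
      (by
        intro v hv σ hσ
        simp only [Finset.product_eq_sprod, Finset.mem_filter, Finset.mem_product,
          Finset.mem_singleton] at hv
        exact insert_mem_rookPlacements hσ hv.1.1 (hv.1.2 ▸ hyC) hv.2)
      (by
        intro v hv σ hσ
        simp only [Finset.product_eq_sprod, Finset.mem_filter, Finset.mem_product,
          Finset.mem_singleton] at hv
        refine ⟨rookPlacements_mono (Finset.erase_subset _ _) (by rw [hv.1.2]) hσ, ?_⟩
        exact lt_of_le_of_lt (card_le_of_mem_rookPlacements hσ)
          (Finset.card_erase_lt_of_mem hv.1.1))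
      (by
        rintro σ ⟨hσ, hσR⟩ hdis
        refine ⟨⟨fun v hv => ⟨(hσ.1 v hv).1, Finset.mem_erase.2 ⟨fun hvy => ?_, (hσ.1 v hv).2.1⟩,
          (hσ.1 v hv).2.2⟩, hσ.2⟩, hσR⟩
        refine Finset.disjoint_right.1 hdis hv ?_
        simp only [Finset.product_eq_sprod, Finset.mem_filter, Finset.mem_product,
          Finset.mem_singleton]
        exact ⟨⟨(hσ.1 v hv).1, hvy⟩, (hσ.1 v hv).2.2⟩)
      hz
      (by
        intro v hv
        simp only [Finset.product_eq_sprod, Finset.mem_filter, Finset.mem_product,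
          Finset.mem_singleton] at hv
        exact hlink C v z hv.1.1 (fun x' hx' => by have := hC x' hx'; omega) hz hdz)
    have hdz₁ : simplexBoundary k e (z - simplexBoundary k e w₁) = 0 := by
      rw [map_sub, hdz, boundary_boundary he, sub_zero]
    -- clear the row `x`
    obtain ⟨w₂, hw₂, hz₂⟩ := exists_boundary_move he
      (S := {σ ∈ rookPlacements r R (C.erase y) | σ.card < R.card})
      (D := rookPlacements r R (C.erase y))
      (T := rookPlacements r (R.erase x) (C.erase y))
      (V := (Finset.product {x} (C.erase y)).filter fun v => r v.1 v.2)
      (L := fun v => rookPlacements r (R.erase v.1) ((C.erase y).erase v.2))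
      (z := z - simplexBoundary k e w₁)
      (by
        intro σ hσ v hv w hw hvσ hwσ
        simp only [Finset.product_eq_sprod, Finset.mem_filter, Finset.mem_product,
          Finset.mem_singleton] at hv hw
        exact hσ.1.2 v hvσ w hwσ (Or.inl (hv.1.1.trans hw.1.1.symm)))
      (by
        intro v hv σ hσ
        simp only [Finset.product_eq_sprod, Finset.mem_filter, Finset.mem_product,
          Finset.mem_singleton] at hv
        exact insert_mem_rookPlacements hσ (hv.1.1 ▸ hx) hv.1.2 hv.2)
      (by
        intro v hv σ hσ
        simp only [Finset.product_eq_sprod, Finset.mem_filter, Finset.mem_product,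
          Finset.mem_singleton] at hv
        exact rookPlacements_mono (by rw [hv.1.1]) (Finset.erase_subset _ _) hσ)
      (by
        rintro σ ⟨hσ, hσR⟩ hdis
        refine ⟨fun v hv => ⟨Finset.mem_erase.2 ⟨fun hvx => ?_, (hσ.1 v hv).1⟩, (hσ.1 v hv).2⟩,
          hσ.2⟩
        refine Finset.disjoint_right.1 hdis hv ?_
        simp only [Finset.product_eq_sprod, Finset.mem_filter, Finset.mem_product,
          Finset.mem_singleton]
        exact ⟨⟨hvx, (hσ.1 v hv).2.1⟩, (hσ.1 v hv).2.2⟩)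
      hz₁
      (by
        intro v hv
        simp only [Finset.product_eq_sprod, Finset.mem_filter, Finset.mem_product,
          Finset.mem_singleton] at hv
        refine hlink (C.erase y) v _ (hv.1.1 ▸ hx) (fun x' hx' => ?_) hz₁ hdz₁
        have h1 := hC x' hx'
        have h2 := hcol C y x'
        omega)
    have hdz₂ : simplexBoundary k e (z - simplexBoundary k e w₁ - simplexBoundary k e w₂) = 0 := by
      rw [map_sub, hdz₁, boundary_boundary he, sub_zero]
    -- cone off with apex `(x, y)`
    refine ⟨w₁ + w₂ + coneVertex k e (x, y)
      (z - simplexBoundary k e w₁ - simplexBoundary k e w₂), add_mem (add_mem hw₁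
      (Finsupp.supported_mono (rookPlacements_mono subset_rfl (Finset.erase_subset _ _)) hw₂))
      (map_mem_supported (fun σ hσ => ?_) hz₂), ?_⟩
    · by_cases hv : (x, y) ∈ σ
      · rw [coneVertex_single_of_mem hv]
        exact zero_mem _
      · rw [coneVertex_single_of_notMem hv]
        exact zsmul_mem (Finsupp.single_mem_supported k _
          (insert_mem_rookPlacements (v := (x, y)) hσ hx hyC hxy)) _
    · rw [map_add, map_add, boundary_cone he, hdz₂, map_zero]
      abel

end Chessboard

/-! ### The Koszul complex of an `FI^m`-module -/

section Subsets

variable {m : ℕ}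

/-- The elements of the object `[n_1] × ⋯ × [n_m]` of `FI^m`. -/
abbrev Pts (n : Fin m → ℕ) : Type := Σ j, Fin (n j)

variable {n : Fin m → ℕ}

/-- The part of a set of elements of `[n_1] × ⋯ × [n_m]` that lies in `[n_j]`. -/
def ptsFiber (A : Finset (Pts n)) (j : Fin m) : Finset (Fin (n j)) :=
  Finset.univ.filter fun i => (⟨j, i⟩ : Pts n) ∈ A

theorem mem_ptsFiber {A : Finset (Pts n)} {j : Fin m} {i : Fin (n j)} :
    i ∈ ptsFiber A j ↔ (⟨j, i⟩ : Pts n) ∈ A := by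
  simp [ptsFiber]

theorem ptsFiber_mono {A B : Finset (Pts n)} (h : A ⊆ B) (j : Fin m) :
    ptsFiber A j ⊆ ptsFiber B j :=
  fun _ hi => mem_ptsFiber.2 (h (mem_ptsFiber.1 hi))

/-- The object of `FI^m` given by a set of elements of `[n_1] × ⋯ × [n_m]`, which sends `A ⊆ B` to
the inclusion. -/
noncomputable def subsetFunctor (n : Fin m → ℕ) : Finset (Pts n) ⥤ FIProd m where
  obj A := FIProd.ofVec fun j => (ptsFiber A j).card
  map {A B} h := fun j =>
    ((ptsFiber A j).equivFin.symm.toEmbedding.trans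
      (Subtype.impEmbedding _ _ fun i hi => ptsFiber_mono (leOfHom h) j hi)).trans
      (ptsFiber B j).equivFin.toEmbedding
  map_id A := by
    funext j
    refine Function.Embedding.ext fun i => ?_
    change (ptsFiber A j).equivFin ((ptsFiber A j).equivFin.symm i) = i
    simp
  map_comp {A B C} f g := by
    funext j
    refine Function.Embedding.ext fun i => ?_
    change (ptsFiber C j).equivFin _ = (ptsFiber C j).equivFin _
    refine congrArg _ (Subtype.ext ?_)
    change _ = (((ptsFiber B j).equivFin.symm ((ptsFiber B j).equivFin _)) : Fin (n j))
    rw [Equiv.symm_apply_apply]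
    rfl

/-- The element of `[n_j]` numbered by `i`. -/
noncomputable def ptsElt (A : Finset (Pts n)) (j : Fin m)
    (i : Fin ((subsetFunctor n).obj A j).card) : Fin (n j) :=
  ((ptsFiber A j).equivFin.symm i).1

theorem ptsElt_injective (A : Finset (Pts n)) (j : Fin m) : Function.Injective (ptsElt A j) :=
  Subtype.val_injective.comp (Equiv.injective _)

theorem ptsElt_mem (A : Finset (Pts n)) (j : Fin m) (i) : (⟨j, ptsElt A j i⟩ : Pts n) ∈ A :=
  mem_ptsFiber.1 ((ptsFiber A j).equivFin.symm i).2

theorem exists_ptsElt {A : Finset (Pts n)} {j : Fin m} {i : Fin (n j)}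
    (h : (⟨j, i⟩ : Pts n) ∈ A) : ∃ i', ptsElt A j i' = i :=
  ⟨(ptsFiber A j).equivFin ⟨i, mem_ptsFiber.2 h⟩, by
    unfold ptsElt
    rw [Equiv.symm_apply_apply]⟩

theorem ptsElt_map {A B : Finset (Pts n)} (h : A ⟶ B) (j : Fin m) (i) :
    ptsElt B j (FI.toEmb ((subsetFunctor n).map h j) i) = ptsElt A j i := by
  change ((ptsFiber B j).equivFin.symm ((ptsFiber B j).equivFin _)).1 = _
  rw [Equiv.symm_apply_apply]
  rfl

theorem subsetFunctor_hom_ext {a : FIProd m} {A : Finset (Pts n)}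
    {f g : a ⟶ (subsetFunctor n).obj A}
    (h : ∀ j i, ptsElt A j (FI.toEmb (f j) i) = ptsElt A j (FI.toEmb (g j) i)) : f = g := by
  funext j
  exact Function.Embedding.ext fun i => ptsElt_injective A j (h j i)

theorem subsetFunctor_map_injective {a : FIProd m} {A B : Finset (Pts n)} (h : A ⟶ B)
    {f g : a ⟶ (subsetFunctor n).obj A}
    (hfg : f ≫ (subsetFunctor n).map h = g ≫ (subsetFunctor n).map h) : f = g := by
  refine subsetFunctor_hom_ext fun j i => ?_
  rw [← ptsElt_map h, ← ptsElt_map h]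
  exact congrArg (fun t : a ⟶ (subsetFunctor n).obj B => ptsElt B j (FI.toEmb (t j) i)) hfg

theorem exists_subsetFunctor_factor {a : FIProd m} {A B : Finset (Pts n)} (h : A ⟶ B)
    (f : a ⟶ (subsetFunctor n).obj B)
    (hf : ∀ j i, (⟨j, ptsElt B j (FI.toEmb (f j) i)⟩ : Pts n) ∈ A) :
    ∃ t : a ⟶ (subsetFunctor n).obj A, t ≫ (subsetFunctor n).map h = f := by
  choose t ht using fun j i => exists_ptsElt (hf j i)
  have hinj : ∀ j, Function.Injective (t j) := fun j i i' hii' => (FI.toEmb (f j)).injective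
    (ptsElt_injective B j (by rw [← ht, ← ht, hii']))
  refine ⟨fun j => (⟨t j, hinj j⟩ : Fin (a j).card ↪ _), subsetFunctor_hom_ext fun j i => ?_⟩
  rw [← ht]
  exact ptsElt_map h j (t j i)

theorem isTransition_subsetFunctor_erase {A : Finset (Pts n)} {s : Pts n} (hs : s ∈ A)
    (h : A.erase s ⟶ A) : IsTransition ((subsetFunctor n).map h) := by
  refine ⟨s.1, fun hbij => ?_⟩
  obtain ⟨i, hi⟩ := exists_ptsElt (A := A) (j := s.1) (i := s.2) hs
  obtain ⟨i', rfl⟩ := hbij.2 i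
  rw [ptsElt_map] at hi
  have := ptsElt_mem (A.erase s) s.1 i'
  rw [hi] at this
  exact Finset.notMem_erase s A this

/-- A non-invertible injection misses an element. Deleting single elements therefore suffices to
generate `V_{<n}`, which becomes the image of the Koszul differential from degree 1. -/
theorem exists_factor_erase {a : FIProd m} {A : Finset (Pts n)} (f : a ⟶ (subsetFunctor n).obj A)
    (hf : IsTransition f) : ∃ s ∈ A, ∃ t : a ⟶ (subsetFunctor n).obj (A.erase s),
      t ≫ (subsetFunctor n).map (homOfLE (Finset.erase_subset s A)) = f := by
  obtain ⟨j, hj⟩ := hf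
  have : ¬ Function.Surjective (FI.toEmb (f j)) := fun h => hj ⟨(FI.toEmb (f j)).injective, h⟩
  simp only [Function.Surjective, not_forall, not_exists] at this
  obtain ⟨i, hi⟩ := this
  refine ⟨⟨j, ptsElt A j i⟩, ptsElt_mem A j i, exists_subsetFunctor_factor _ f fun j' i' => ?_⟩
  refine Finset.mem_erase.2 ⟨fun h => ?_, ptsElt_mem A j' _⟩
  obtain rfl : j' = j := congrArg Sigma.fst h
  exact hi i' (ptsElt_injective A j' (by simpa using h))

theorem subsetFunctor_obj_univ (n : Fin m → ℕ) :
    (subsetFunctor n).obj Finset.univ = FIProd.ofVec n := by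
  funext j
  change FI.mk (ptsFiber Finset.univ j).card = FI.mk (n j)
  simp [ptsFiber]

/-- An injective rank function on the elements, used to define signs. -/
noncomputable def ptsRank (s : Pts n) : ℕ := (Fintype.equivFin (Pts n) s : ℕ)

theorem ptsRank_injective : Function.Injective (ptsRank (n := n)) :=
  Fin.val_injective.comp (Equiv.injective _)

end Subsets

/-! ### Koszul chains, their differential and functoriality -/

section Koszul

variable {k : Type u} [CommRing k] {m : ℕ} {n : Fin m → ℕ} {V W : FIMod k m}

/-- The Koszul complex of `V` in degree `n`: families of elements of `V`, indexed by the sets of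
elements of `[n_1] × ⋯ × [n_m]`. -/
abbrev Koszul (V : FIMod k m) (n : Fin m → ℕ) : Type u :=
  ∀ A : Finset (Pts n), V.obj ((subsetFunctor n).obj A)

/-- A family is homogeneous of degree `p` if it is supported on the sets of codimension `p`. -/
def Koszul.IsHomogeneous (p : ℕ) (x : Koszul V n) : Prop :=
  ∀ A : Finset (Pts n), A.card + p ≠ Fintype.card (Pts n) → x A = 0

/-- The map on `V` given by the inclusion of a set of elements into a larger one. -/
noncomputable def inclMap (V : FIMod k m) {A B : Finset (Pts n)} (h : A ⊆ B) :
    V.obj ((subsetFunctor n).obj A) →ₗ[k] V.obj ((subsetFunctor n).obj B) :=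
  (V.map ((subsetFunctor n).map (homOfLE h))).hom

theorem inclMap_inclMap {A B C : Finset (Pts n)} (h : A ⊆ B) (h' : B ⊆ C)
    (v : V.obj ((subsetFunctor n).obj A)) :
    inclMap V h' (inclMap V h v) = inclMap V (h.trans h') v := by
  unfold inclMap
  rw [← LinearMap.comp_apply, ← ModuleCat.hom_comp, ← V.map_comp, ← Functor.map_comp]
  rfl

theorem app_inclMap (φ : V ⟶ W) {A B : Finset (Pts n)} (h : A ⊆ B)
    (v : V.obj ((subsetFunctor n).obj A)) :
    (φ.app _).hom (inclMap V h v) = inclMap W h ((φ.app _).hom v) :=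
  NatTrans.naturality_apply φ _ v

/-- The Koszul differential. -/
noncomputable def Koszul.d : Koszul V n →ₗ[k] Koszul V n where
  toFun x A := ∑ s ∈ A, rankSign ptsRank s A • inclMap V (Finset.erase_subset s A) (x (A.erase s))
  map_add' x y := by
    funext A
    simp [Finset.sum_add_distrib]
  map_smul' r x := by
    funext A
    simp [Finset.smul_sum, smul_comm r]

theorem Koszul.d_apply (x : Koszul V n) (A : Finset (Pts n)) : Koszul.d x A =
    ∑ s ∈ A, rankSign ptsRank s A • inclMap V (Finset.erase_subset s A) (x (A.erase s)) := rfl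

/-- The map of Koszul complexes induced by a map of modules. -/
noncomputable def Koszul.map (φ : V ⟶ W) : Koszul V n →ₗ[k] Koszul W n where
  toFun x A := (φ.app _).hom (x A)
  map_add' x y := by
    funext A
    simp
  map_smul' r x := by
    funext A
    simp

theorem Koszul.map_apply (φ : V ⟶ W) (x : Koszul V n) (A : Finset (Pts n)) :
    Koszul.map φ x A = (φ.app _).hom (x A) := rfl

theorem Koszul.map_d (φ : V ⟶ W) (x : Koszul V n) :
    Koszul.map φ (Koszul.d x) = Koszul.d (Koszul.map φ x) := by
  funext A
  rw [Koszul.map_apply, Koszul.d_apply, Koszul.d_apply, map_sum]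
  refine Finset.sum_congr rfl fun s _ => ?_
  rw [map_zsmul, app_inclMap]
  rfl

theorem Koszul.d_d (x : Koszul V n) : Koszul.d (Koszul.d x) = 0 := by
  funext A
  rw [Koszul.d_apply]
  have h1 : ∀ s ∈ A, rankSign ptsRank s A •
      inclMap V (Finset.erase_subset s A) (Koszul.d x (A.erase s)) =
      ∑ t ∈ A.erase s, (rankSign ptsRank s A * rankSign ptsRank t (A.erase s)) • inclMap V
        (((A.erase s).erase_subset t).trans (A.erase_subset s)) (x ((A.erase s).erase t)) := by
    intro s _
    rw [Koszul.d_apply, map_sum, Finset.smul_sum]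
    refine Finset.sum_congr rfl fun t _ => ?_
    rw [map_zsmul, inclMap_inclMap, smul_smul]
  rw [Finset.sum_congr rfl h1, Finset.sum_sigma']
  refine Finset.sum_involution (fun p _ => ⟨p.2, p.1⟩) ?_ ?_ ?_ ?_
  · rintro ⟨s, t⟩ hp
    simp only [Finset.mem_sigma, Finset.mem_erase] at hp
    -- The two orders of deletion give equal sets that are not definitionally equal, so the value of
    -- `x` has to be transported.
    have key : ∀ B C : Finset (Pts n), B = C → ∀ (hB : B ⊆ A) (hC : C ⊆ A),
        inclMap V hB (x B) = inclMap V hC (x C) := by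
      rintro B C rfl _ _
      rfl
    rw [rankSign_erase ptsRank_injective hp.1 hp.2.2 (Ne.symm hp.2.1), neg_smul,
      key _ _ (Finset.erase_right_comm (s := A) (a := s) (b := t)) _
        (((A.erase t).erase_subset s).trans (A.erase_subset t)), neg_add_cancel]
  · rintro ⟨s, t⟩ hp _ heq
    simp only [Finset.mem_sigma, Finset.mem_erase] at hp
    exact hp.2.1 (congrArg Sigma.fst heq)
  · rintro ⟨s, t⟩ hp
    simp only [Finset.mem_sigma, Finset.mem_erase] at hp ⊢
    exact ⟨hp.2.2, Ne.symm hp.2.1, hp.1⟩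
  · rintro ⟨s, t⟩ _
    rfl

theorem Koszul.IsHomogeneous.d {p : ℕ} {x : Koszul V n} (hx : x.IsHomogeneous (p + 1)) :
    (Koszul.d x).IsHomogeneous p := by
  intro A hA
  rw [Koszul.d_apply]
  refine Finset.sum_eq_zero fun s hs => ?_
  have := Finset.card_erase_add_one hs
  rw [hx _ (by omega), map_zero, smul_zero]

theorem Koszul.IsHomogeneous.map {p : ℕ} {x : Koszul V n} (hx : x.IsHomogeneous p) (φ : V ⟶ W) :
    (Koszul.map φ x).IsHomogeneous p := by
  intro A hA
  rw [Koszul.map_apply, hx A hA, map_zero]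

theorem Koszul.IsHomogeneous.add {p : ℕ} {x y : Koszul V n} (hx : x.IsHomogeneous p)
    (hy : y.IsHomogeneous p) : (x + y).IsHomogeneous p := by
  intro A hA
  rw [Pi.add_apply, hx A hA, hy A hA, add_zero]

theorem Koszul.IsHomogeneous.sub {p : ℕ} {x y : Koszul V n} (hx : x.IsHomogeneous p)
    (hy : y.IsHomogeneous p) : (x - y).IsHomogeneous p := by
  intro A hA
  rw [Pi.sub_apply, hx A hA, hy A hA, sub_zero]

/-- Elementwise preimages in homogeneous Koszul chains. -/
theorem Koszul.exists_homogeneous {p : ℕ} {P : ∀ A : Finset (Pts n),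
    V.obj ((subsetFunctor n).obj A) → Prop}
    (h0 : ∀ A : Finset (Pts n), A.card + p ≠ Fintype.card (Pts n) → P A 0)
    (h : ∀ A : Finset (Pts n), A.card + p = Fintype.card (Pts n) → ∃ v, P A v) :
    ∃ x : Koszul V n, x.IsHomogeneous p ∧ ∀ A, P A (x A) := by
  have h' : ∀ A : Finset (Pts n), ∃ v : V.obj ((subsetFunctor n).obj A),
      (A.card + p ≠ Fintype.card (Pts n) → v = 0) ∧ P A v := by
    intro A
    by_cases hA : A.card + p = Fintype.card (Pts n)
    · obtain ⟨v, hv⟩ := h A hA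
      exact ⟨v, fun h => absurd hA h, hv⟩
    · exact ⟨0, fun _ => rfl, h0 A hA⟩
  choose x hx hP using h'
  exact ⟨x, hx, hP⟩

end Koszul

/-! ### Acyclicity of the Koszul complex on projective modules -/

/-- Insertion of a fixed `s` contracts the cube of all subsets. If `s ∈ A`, only the term `t = s`
survives; if `s ∉ A`, the closedness of `g` at `insert s A` gives the claim. -/
theorem cube_homotopy {W O M : Type*} [DecidableEq W] [LinearOrder O] [AddCommGroup M] {e : W → O}
    (he : Function.Injective e) {g : Finset W → M}
    (hg : ∀ A, ∑ t ∈ A, rankSign e t A • g (A.erase t) = 0) (s : W) (A : Finset W) :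
    ∑ t ∈ A, rankSign e t A • (if s ∈ A.erase t then 0 else
      rankSign e s (insert s (A.erase t)) • g (insert s (A.erase t))) = g A := by
  by_cases hs : s ∈ A
  · rw [Finset.sum_eq_single_of_mem s hs, if_neg (Finset.notMem_erase s A), Finset.insert_erase hs,
      smul_smul, rankSign_mul_self, one_smul]
    intro t _ hts
    rw [if_pos (Finset.mem_erase.2 ⟨hts.symm, hs⟩), smul_zero]
  · have h1 := hg (insert s A)
    rw [Finset.sum_insert hs, Finset.erase_insert hs] at h1
    have h2 : ∀ t ∈ A, rankSign e t A • (if s ∈ A.erase t then 0 else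
        rankSign e s (insert s (A.erase t)) • g (insert s (A.erase t))) =
        (-rankSign e s (insert s A)) • (rankSign e t (insert s A) • g ((insert s A).erase t)) := by
      intro t ht
      have hts : t ≠ s := fun h => hs (h ▸ ht)
      have key := rankSign_erase he (Finset.mem_insert_of_mem ht) (Finset.mem_insert_self s A) hts
      rw [Finset.erase_insert hs, Finset.erase_insert_of_ne hts.symm] at key
      rw [if_neg fun h => hs (Finset.mem_of_mem_erase h), Finset.erase_insert_of_ne hts.symm,
        smul_smul, smul_smul]
      congr 1
      have a1 := rankSign_mul_self e t A
      have a2 := rankSign_mul_self e t (insert s A)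
      linear_combination (-rankSign e s (insert s (A.erase t)) * rankSign e t A) * a2 +
        rankSign e t (insert s A) * rankSign e t A * key -
        rankSign e t (insert s A) * rankSign e s (insert s A) * a1
    rw [Finset.sum_congr rfl h2, ← Finset.smul_sum, eq_neg_of_add_eq_zero_right h1, smul_neg,
      neg_smul, neg_neg, smul_smul, rankSign_mul_self, one_smul]

section Free

variable {k : Type u} [CommRing k] {m : ℕ} {n : Fin m → ℕ}

/-- Composition with `g` on the basis of a free module. -/
def freePush {ι : Type u} (o : ι → FIProd m) {b c : FIProd m} (g : b ⟶ c) (p : Σ i, (o i ⟶ b)) :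
    Σ i, (o i ⟶ c) :=
  ⟨p.1, p.2 ≫ g⟩

/-- The free module with generators in the degrees `o i`. -/
noncomputable def freeMod (k : Type u) [CommRing k] {ι : Type u} (o : ι → FIProd m) :
    FIMod k m where
  obj b := ModuleCat.of k ((Σ i, (o i ⟶ b)) →₀ k)
  map g := ModuleCat.ofHom (Finsupp.lmapDomain k k (freePush o g))
  map_id b := by
    refine ModuleCat.hom_ext (Finsupp.lhom_ext' fun p => LinearMap.ext_ring ?_)
    simp [freePush]
  map_comp g h := by
    refine ModuleCat.hom_ext (Finsupp.lhom_ext' fun p => LinearMap.ext_ring ?_)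
    simp [freePush]

variable {ι : Type u} {o : ι → FIProd m} {V : FIMod k m}

/-- The basis element of a free module given by a generator and a morphism. -/
noncomputable def freeMod.basis (k : Type u) [CommRing k] {o : ι → FIProd m} {b : FIProd m}
    (i : ι) (f : o i ⟶ b) : (freeMod k o).obj b :=
  (Finsupp.single ⟨i, f⟩ 1 : (Σ i, (o i ⟶ b)) →₀ k)

theorem freeMod.map_basis {b c : FIProd m} (g : b ⟶ c) (i : ι) (f : o i ⟶ b) :
    ((freeMod k o).map g).hom (freeMod.basis k i f) = freeMod.basis k i (f ≫ g) :=
  Finsupp.mapDomain_single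

theorem freeMod.linearMap_ext {M : Type*} [AddCommGroup M] [Module k M] {b : FIProd m}
    {φ ψ : (freeMod k o).obj b →ₗ[k] M}
    (h : ∀ i f, φ (freeMod.basis k i f) = ψ (freeMod.basis k i f)) : φ = ψ :=
  Finsupp.lhom_ext' fun p => LinearMap.ext_ring (h p.1 p.2)

/-- The linear extension to a free module of a map on its basis. -/
noncomputable def freeMod.lift {M : Type*} [AddCommGroup M] [Module k M] {b : FIProd m}
    (φ : ∀ i, (o i ⟶ b) → M) : (freeMod k o).obj b →ₗ[k] M :=
  Finsupp.linearCombination k fun p : Σ i, (o i ⟶ b) => φ p.1 p.2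

theorem freeMod.lift_basis {M : Type*} [AddCommGroup M] [Module k M] {b : FIProd m}
    (φ : ∀ i, (o i ⟶ b) → M) (i : ι) (f : o i ⟶ b) :
    freeMod.lift (k := k) φ (freeMod.basis k i f) = φ i f :=
  (Finsupp.linearCombination_single k 1 _).trans (one_smul k _)

/-- The map from a free module given by the images of the generators. -/
noncomputable def freeMod.desc (v : ∀ i, V.obj (o i)) : freeMod k o ⟶ V where
  app b := ModuleCat.ofHom (freeMod.lift fun i f => (V.map f).hom (v i))
  naturality b c g := by
    refine ModuleCat.hom_ext (freeMod.linearMap_ext fun i f => ?_)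
    change freeMod.lift (fun i f => (V.map f).hom (v i))
        (((freeMod k o).map g).hom (freeMod.basis k i f)) =
      (V.map g).hom (freeMod.lift (fun i f => (V.map f).hom (v i)) (freeMod.basis k i f))
    rw [freeMod.map_basis, freeMod.lift_basis, freeMod.lift_basis]
    simp

theorem freeMod.desc_basis (v : ∀ i, V.obj (o i)) {b : FIProd m} (i : ι) (f : o i ⟶ b) :
    ((freeMod.desc v).app b).hom (freeMod.basis k i f) = (V.map f).hom (v i) :=
  freeMod.lift_basis _ i f

/-- The element `s` is not in the image of `f`. -/
def Avoids {a : FIProd m} (f : a ⟶ (subsetFunctor n).obj Finset.univ) (s : Pts n) : Prop :=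
  ∀ j i, (⟨j, ptsElt Finset.univ j (FI.toEmb (f j) i)⟩ : Pts n) ≠ s

/-- The coefficient of an element of a free module. -/
noncomputable def freeMod.coeff {b : FIProd m} (p : Σ i, (o i ⟶ b)) :
    (freeMod k o).obj b →ₗ[k] k :=
  Finsupp.lapply p

/-- Inclusions are monomorphisms, so all components of a Koszul chain of a free module can be
compared inside the value at the full set. -/
theorem freeMod.inclMap_univ_injective (A : Finset (Pts n)) :
    Function.Injective (inclMap (freeMod k o) A.subset_univ) := by
  refine Finsupp.mapDomain_injective ?_
  rintro ⟨i, f⟩ ⟨i', f'⟩ h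
  obtain rfl : i = i' := congrArg Sigma.fst h
  simp only [freePush, Sigma.mk.injEq, heq_eq_eq, true_and] at h
  rw [subsetFunctor_map_injective _ h]

theorem freeMod.avoids_of_coeff_ne_zero {A : Finset (Pts n)}
    (v : (freeMod k o).obj ((subsetFunctor n).obj A)) (p : Σ i, (o i ⟶ _))
    (hp : freeMod.coeff p (inclMap (freeMod k o) A.subset_univ v) ≠ 0) {s : Pts n} (hs : s ∉ A) :
    Avoids p.2 s := by
  classical
  have hmem : p ∈ (Finsupp.mapDomain (freePush o ((subsetFunctor n).map (homOfLE A.subset_univ)))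
    v).support := Finsupp.mem_support_iff.2 hp
  obtain ⟨⟨i, f⟩, -, rfl⟩ := Finset.mem_image.1 (Finsupp.mapDomain_support hmem)
  intro j i' h
  refine hs (h ▸ ?_)
  have := ptsElt_map (homOfLE A.subset_univ) j (FI.toEmb (f j) i')
  change (⟨j, ptsElt Finset.univ j (FI.toEmb ((subsetFunctor n).map (homOfLE A.subset_univ) j)
    (FI.toEmb (f j) i'))⟩ : Pts n) ∈ A
  rw [this]
  exact ptsElt_mem A j _

theorem freeMod.exists_inclMap_eq {A : Finset (Pts n)}
    (w : (freeMod k o).obj ((subsetFunctor n).obj Finset.univ))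
    (hw : ∀ p, freeMod.coeff p w ≠ 0 → ∀ s ∉ A, Avoids p.2 s) :
    ∃ v, inclMap (freeMod k o) A.subset_univ v = w := by
  suffices h : w ∈ LinearMap.range (inclMap (freeMod k o) A.subset_univ) from h
  let w' : (Σ i, (o i ⟶ (subsetFunctor n).obj Finset.univ)) →₀ k := w
  have : w = w'.sum Finsupp.single := (Finsupp.sum_single w').symm
  rw [this]
  refine sum_mem fun p hp => ?_
  obtain ⟨i, f⟩ := p
  obtain ⟨t, ht⟩ := exists_subsetFunctor_factor (homOfLE A.subset_univ) f fun j i' => by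
    by_contra hh
    exact hw _ (Finsupp.mem_support_iff.1 hp) _ hh j i' rfl
  refine ⟨(Finsupp.single ⟨i, t⟩ (w' ⟨i, f⟩) : _ →₀ k), (Finsupp.mapDomain_single).trans ?_⟩
  rw [freePush, ht]

/-- The complex splits over the basis elements at the full set. One that avoids some `s` is handled
by inserting `s`; the filling remains supported on sets containing the image, because the image does
not use `s`. One that avoids nothing occurs only at the full set, which has codimension `0 < p`. -/
theorem freeMod.koszul_exact {p : ℕ} (hp : 1 ≤ p) (x : Koszul (freeMod k o) n)
    (hx : x.IsHomogeneous p) (hdx : Koszul.d x = 0) :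
    ∃ y : Koszul (freeMod k o) n, y.IsHomogeneous (p + 1) ∧ Koszul.d y = x := by
  classical
  let E := Σ i, (o i ⟶ (subsetFunctor n).obj Finset.univ)
  let xh : Finset (Pts n) → (E →₀ k) := fun A => inclMap (freeMod k o) A.subset_univ (x A)
  have hxh : ∀ A, A.card + p ≠ Fintype.card (Pts n) → xh A = 0 := by
    intro A hA
    change inclMap (freeMod k o) A.subset_univ (x A) = 0
    rw [hx A hA, map_zero]
  have hincl : ∀ (y : Koszul (freeMod k o) n) A,
      inclMap (freeMod k o) A.subset_univ (Koszul.d y A) = ∑ s ∈ A, rankSign ptsRank s A •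
        inclMap (freeMod k o) (A.erase s).subset_univ (y (A.erase s)) := by
    intro y A
    rw [Koszul.d_apply, map_sum]
    refine Finset.sum_congr rfl fun s _ => ?_
    rw [map_zsmul, inclMap_inclMap]
  -- A choice of an avoided element for each basis element; `none` stands for the surjective ones.
  let c : E → Option (Pts n) := fun e => if h : ∃ s, Avoids e.2 s then some h.choose else none
  have hc : ∀ e s, c e = some s → Avoids e.2 s := by
    intro e s h
    simp only [c] at h
    split_ifs at h with h'
    obtain rfl := Option.some.inj h
    exact h'.choose_spec
  have hc' : ∀ e, c e = none → ∀ s, ¬ Avoids e.2 s := by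
    intro e h s hs
    simp only [c] at h
    rw [dif_pos ⟨s, hs⟩] at h
    exact Option.some_ne_none _ h
  -- The homotopy of `cube_homotopy` for all basis elements at once: the filter lets each one use
  -- its own element `s`.
  let yh : Finset (Pts n) → (E →₀ k) := fun A => ∑ s ∈ Aᶜ,
    rankSign ptsRank s (insert s A) • (xh (insert s A)).filter fun e => c e = some s
  have hyh_none : ∀ A e, c e = none → yh A e = 0 := by
    intro A e he
    simp only [yh, Finsupp.finsetSum_apply, Finsupp.smul_apply]
    refine Finset.sum_eq_zero fun s _ => ?_
    rw [Finsupp.filter_apply_neg _ _ (by simp [he]), smul_zero]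
  have hyh_some : ∀ A e s, c e = some s → yh A e = if s ∈ A then 0 else
      rankSign ptsRank s (insert s A) • xh (insert s A) e := by
    intro A e s he
    simp only [yh, Finsupp.finsetSum_apply, Finsupp.smul_apply]
    split_ifs with hs
    · refine Finset.sum_eq_zero fun t ht => ?_
      rw [Finsupp.filter_apply_neg, smul_zero]
      rw [he]
      intro h
      exact Finset.mem_compl.1 ht (Option.some.inj h ▸ hs)
    · rw [Finset.sum_eq_single_of_mem s (Finset.mem_compl.2 hs),
        Finsupp.filter_apply_pos (fun e => c e = some s) _ he]
      intro t _ hts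
      rw [Finsupp.filter_apply_neg, smul_zero]
      rw [he]
      exact fun h => hts (Option.some.inj h).symm
  obtain ⟨y, hy, hyA⟩ := Koszul.exists_homogeneous (V := freeMod k o) (n := n) (p := p + 1)
    (P := fun A v => inclMap (freeMod k o) A.subset_univ v = yh A)
    (by
      intro A hA
      refine (map_zero _).trans (Finset.sum_eq_zero fun s hs => ?_).symm
      have hcard := Finset.card_insert_of_notMem (Finset.mem_compl.1 hs)
      rw [hxh _ (by omega), Finsupp.filter_zero, smul_zero]
      rfl)
    (by
      intro A _
      refine freeMod.exists_inclMap_eq _ fun e he t ht => ?_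
      change yh A e ≠ 0 at he
      rcases hce : c e with _ | s
      · exact absurd (hyh_none A e hce) he
      · rw [hyh_some A e s hce] at he
        split_ifs at he with hs
        · exact absurd rfl he
        · by_cases hts : t = s
          · exact hts ▸ hc e s hce
          · refine freeMod.avoids_of_coeff_ne_zero (x (insert s A)) e (fun h0 => he ?_)
              (by simp [hts, ht])
            rw [show xh (insert s A) e = 0 from h0, smul_zero])
  refine ⟨y, hy, funext fun A => freeMod.inclMap_univ_injective A ?_⟩
  rw [hincl, Finset.sum_congr rfl fun s _ => by rw [hyA (A.erase s)]]
  refine Finsupp.ext fun e => ?_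
  change _ = xh A e
  refine (Finsupp.finsetSum_apply A
    (fun s => rankSign ptsRank s A • yh (A.erase s)) e).trans ?_
  rcases hce : c e with _ | s
  · rw [Finset.sum_eq_zero]
    · by_contra h0
      by_cases hA : A = Finset.univ
      · refine h0 (Eq.symm ?_)
        rw [hxh A (by rw [hA, Finset.card_univ]; omega)]
        rfl
      · obtain ⟨t, ht⟩ : ∃ t, t ∉ A := by
          by_contra! h
          exact hA (Finset.eq_univ_iff_forall.2 h)
        exact hc' e hce t (freeMod.avoids_of_coeff_ne_zero (x A) e (fun h => h0 h.symm) ht)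
    · intro s _
      rw [Finsupp.smul_apply, hyh_none _ _ hce, smul_zero]
  · refine Eq.trans (Finset.sum_congr rfl fun t _ => ?_) (cube_homotopy ptsRank_injective
      (g := fun B => xh B e) (fun B => ?_) s A)
    · rw [Finsupp.smul_apply, hyh_some _ _ _ hce]
    · have h1 := hincl x B
      rw [hdx, Pi.zero_apply, map_zero] at h1
      have h2 := (Finsupp.finsetSum_apply B
        (fun s => rankSign ptsRank s B • xh (B.erase s)) e).symm
      refine (Eq.trans ?_ h2).trans (DFunLike.congr_fun (F := E →₀ k) h1.symm e)
      rfl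

/-- A projective module is a retract of a free one, and Koszul chains are functorial. -/
theorem koszul_exact_of_projective {P : FIMod k m} [Projective P] {p : ℕ} (hp : 1 ≤ p)
    (x : Koszul P n) (hx : x.IsHomogeneous p) (hdx : Koszul.d x = 0) :
    ∃ y : Koszul P n, y.IsHomogeneous (p + 1) ∧ Koszul.d y = x := by
  let π : freeMod k (fun i : Σ a, P.obj a => i.1) ⟶ P := freeMod.desc fun i => i.2
  have hπ : ∀ a, Epi (π.app a) := fun a => by
    rw [ModuleCat.epi_iff_surjective]
    intro v
    refine ⟨freeMod.basis k ⟨a, v⟩ (𝟙 a), ?_⟩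
    exact (freeMod.desc_basis _ _ _).trans (by simp)
  have : Epi π := NatTrans.epi_of_epi_app π
  let s : P ⟶ _ := Projective.factorThru (𝟙 P) π
  have hs : s ≫ π = 𝟙 P := Projective.factorThru_comp _ _
  obtain ⟨y, hy, hdy⟩ := freeMod.koszul_exact hp (Koszul.map s x) (hx.map s)
    (by rw [← Koszul.map_d, hdx, map_zero])
  refine ⟨Koszul.map π y, hy.map π, ?_⟩
  rw [← Koszul.map_d, hdy]
  funext A
  exact congrArg (fun t : P ⟶ P => (t.app _).hom (x A)) hs

end Free

/-! ### The universal Koszul complex and chessboard complexes -/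

section Universal

variable {k : Type u} [CommRing k] {m : ℕ} {n : Fin m → ℕ} {V W : FIMod k m}

/-- The free module representing Koszul chains of degree `n`. -/
noncomputable abbrev koszulFree (k : Type u) [CommRing k] {m : ℕ} (n : Fin m → ℕ) : FIMod k m :=
  freeMod k fun A : ULift.{u} (Finset (Pts n)) => (subsetFunctor n).obj A.down

/-- The universal Koszul chain. -/
noncomputable def koszulUniv (k : Type u) [CommRing k] {m : ℕ} (n : Fin m → ℕ) :
    Koszul (koszulFree k n) n :=
  fun A => freeMod.basis k (ULift.up A) (𝟙 ((subsetFunctor n).obj A))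

/-- The map from the free module `koszulFree k n` which is given by a Koszul chain. -/
noncomputable def koszulHom (x : Koszul V n) : koszulFree k n ⟶ V :=
  freeMod.desc fun A => x A.down

theorem koszulHom_basis (x : Koszul V n) {b : FIProd m} (A : Finset (Pts n))
    (f : (subsetFunctor n).obj A ⟶ b) :
    ((koszulHom x).app b).hom (freeMod.basis k (ULift.up A) f) = (V.map f).hom (x A) :=
  freeMod.desc_basis _ _ _

theorem map_koszulHom_koszulUniv (x : Koszul V n) :
    Koszul.map (koszulHom x) (koszulUniv k n) = x := by
  funext A
  refine (koszulHom_basis x A _).trans ?_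
  simp

theorem koszulFree_hom_ext {φ ψ : koszulFree k n ⟶ V}
    (h : ∀ A, (φ.app _).hom (koszulUniv k n A) = (ψ.app _).hom (koszulUniv k n A)) : φ = ψ := by
  ext b : 2
  refine ModuleCat.hom_ext (freeMod.linearMap_ext fun A f => ?_)
  obtain ⟨A⟩ := A
  have key : freeMod.basis k (ULift.up A) f =
      ((koszulFree k n).map f).hom (koszulUniv k n A) := by
    refine Eq.trans ?_ (freeMod.map_basis (k := k)
      (o := fun A : ULift.{u} (Finset (Pts n)) => (subsetFunctor n).obj A.down)
      f (ULift.up A) (𝟙 _)).symm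
    rw [Category.id_comp]
  rw [key]
  exact (NatTrans.naturality_apply φ f _).trans
    ((congrArg (V.map f).hom (h A)).trans (NatTrans.naturality_apply ψ f _).symm)

theorem koszulHom_comp (x : Koszul V n) (φ : V ⟶ W) :
    koszulHom x ≫ φ = koszulHom (Koszul.map φ x) := by
  refine koszulFree_hom_ext fun A => ?_
  refine Eq.trans ?_ (congrFun (map_koszulHom_koszulUniv (Koszul.map φ x)) A).symm
  exact congrArg (φ.app _).hom (congrFun (map_koszulHom_koszulUniv x) A)

/-- The universal Koszul differential. -/
noncomputable def koszulBoundary (k : Type u) [CommRing k] {m : ℕ} (n : Fin m → ℕ) :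
    koszulFree k n ⟶ koszulFree k n :=
  koszulHom (Koszul.d (koszulUniv k n))

/-- Yoneda: under the correspondence between chains and maps out of `koszulFree`, the differential
is precomposition with the universal boundary. Exactness questions about chains thus become
extension problems for maps. -/
theorem koszulBoundary_comp (x : Koszul V n) :
    koszulBoundary k n ≫ koszulHom x = koszulHom (Koszul.d x) := by
  rw [koszulBoundary, koszulHom_comp, Koszul.map_d, map_koszulHom_koszulUniv]

theorem koszulBoundary_basis {b : FIProd m} (A : Finset (Pts n))
    (f : (subsetFunctor n).obj A ⟶ b) :
    ((koszulBoundary k n).app b).hom (freeMod.basis k (ULift.up A) f) =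
      ∑ s ∈ A, rankSign ptsRank s A • freeMod.basis k (ULift.up (A.erase s))
        ((subsetFunctor n).map (homOfLE (Finset.erase_subset s A)) ≫ f) := by
  refine (koszulHom_basis _ A f).trans ?_
  rw [Koszul.d_apply, map_sum]
  refine Finset.sum_congr rfl fun s _ => ?_
  rw [map_zsmul]
  congr 1
  have h1 : inclMap (koszulFree k n) (Finset.erase_subset s A) (koszulUniv k n (A.erase s)) =
      freeMod.basis k (ULift.up (A.erase s))
        (𝟙 _ ≫ (subsetFunctor n).map (homOfLE (Finset.erase_subset s A))) :=
    freeMod.map_basis _ _ _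
  rw [h1]
  refine (freeMod.map_basis _ _ _).trans ?_
  rw [Category.id_comp]

variable {b : FIProd m}

/-- The graph of a partial injection. -/
noncomputable def injGraph (A : Finset (Pts n)) (f : (subsetFunctor n).obj A ⟶ b) :
    Finset (Pts n × Pts fun j => (b j).card) :=
  Finset.univ.image fun p : Σ j, Fin ((subsetFunctor n).obj A j).card =>
    (⟨p.1, ptsElt A p.1 p.2⟩, ⟨p.1, FI.toEmb (f p.1) p.2⟩)

theorem mem_injGraph {A : Finset (Pts n)} {f : (subsetFunctor n).obj A ⟶ b}
    {v : Pts n × Pts fun j => (b j).card} :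
    v ∈ injGraph A f ↔ ∃ j i, v = (⟨j, ptsElt A j i⟩, ⟨j, FI.toEmb (f j) i⟩) := by
  simp only [injGraph, Finset.mem_image, Finset.mem_univ, true_and, Sigma.exists]
  exact ⟨fun ⟨j, i, h⟩ => ⟨j, i, h.symm⟩, fun ⟨j, i, h⟩ => ⟨j, i, h.symm⟩⟩

theorem injGraph_mem_rookPlacements (A : Finset (Pts n)) (f : (subsetFunctor n).obj A ⟶ b) :
    injGraph A f ∈ rookPlacements (fun x y => x.1 = y.1) Finset.univ Finset.univ := by
  refine ⟨fun v hv => ?_, fun v hv w hw h => ?_⟩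
  · obtain ⟨j, i, rfl⟩ := mem_injGraph.1 hv
    simp
  · obtain ⟨j, i, rfl⟩ := mem_injGraph.1 hv
    obtain ⟨j', i', rfl⟩ := mem_injGraph.1 hw
    obtain rfl : j = j' := by rcases h with h | h <;> exact congrArg Sigma.fst h
    obtain rfl : i = i' := by
      rcases h with h | h
      · exact ptsElt_injective A j (by simpa using h)
      · exact (FI.toEmb (f j)).injective (by simpa using h)
    rfl

theorem injGraph_image_fst (A : Finset (Pts n)) (f : (subsetFunctor n).obj A ⟶ b) :
    (injGraph A f).image Prod.fst = A := by
  ext s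
  simp only [Finset.mem_image, mem_injGraph]
  constructor
  · rintro ⟨_, ⟨j, i, rfl⟩, rfl⟩
    exact ptsElt_mem A j i
  · intro hs
    obtain ⟨i, hi⟩ := exists_ptsElt (A := A) (j := s.1) (i := s.2) hs
    exact ⟨_, ⟨s.1, i, rfl⟩, by rw [hi]⟩

theorem injGraph_fst_injOn (A : Finset (Pts n)) (f : (subsetFunctor n).obj A ⟶ b) :
    Set.InjOn Prod.fst (injGraph A f : Set (Pts n × Pts fun j => (b j).card)) :=
  fun v hv w hw h => (injGraph_mem_rookPlacements A f).2 v hv w hw (Or.inl h)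

theorem card_injGraph (A : Finset (Pts n)) (f : (subsetFunctor n).obj A ⟶ b) :
    (injGraph A f).card = A.card := by
  rw [← Finset.card_image_of_injOn (injGraph_fst_injOn A f), injGraph_image_fst]

theorem injGraph_erase {A : Finset (Pts n)} (f : (subsetFunctor n).obj A ⟶ b)
    {v : Pts n × Pts fun j => (b j).card} (hv : v ∈ injGraph A f) :
    injGraph (A.erase v.1) ((subsetFunctor n).map (homOfLE (Finset.erase_subset v.1 A)) ≫ f) =
      (injGraph A f).erase v := by
  ext w
  rw [Finset.mem_erase]
  constructor
  · intro hw
    obtain ⟨j, i, rfl⟩ := mem_injGraph.1 hw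
    refine ⟨fun h => ?_, mem_injGraph.2 ⟨j, FI.toEmb ((subsetFunctor n).map
      (homOfLE (Finset.erase_subset v.1 A)) j) i, ?_⟩⟩
    · have := ptsElt_mem (A.erase v.1) j i
      exact Finset.ne_of_mem_erase this (congrArg Prod.fst h)
    · rw [ptsElt_map]
      rfl
  · rintro ⟨hne, hw⟩
    have hwv : w.1 ≠ v.1 := fun h => hne (injGraph_fst_injOn A f hw hv h)
    obtain ⟨j, i, rfl⟩ := mem_injGraph.1 hw
    obtain ⟨i', hi'⟩ := exists_ptsElt (Finset.mem_erase.2 ⟨hwv, ptsElt_mem A j i⟩)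
    refine mem_injGraph.2 ⟨j, i', ?_⟩
    have h2 : FI.toEmb ((subsetFunctor n).map (homOfLE (Finset.erase_subset v.1 A)) j) i' = i :=
      ptsElt_injective A j (by rw [ptsElt_map, hi'])
    rw [hi']
    change _ = (_, (⟨j, FI.toEmb (f j) (FI.toEmb ((subsetFunctor n).map
      (homOfLE (Finset.erase_subset v.1 A)) j) i')⟩ : Pts fun j => (b j).card))
    rw [h2]

/-- The lexicographic rank function on the fields of a chessboard. -/
noncomputable def fieldRank {n n' : Fin m → ℕ} (v : Pts n × Pts n') : ℕ ×ₗ ℕ :=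
  toLex (ptsRank v.1, ptsRank v.2)

theorem fieldRank_injective {n n' : Fin m → ℕ} :
    Function.Injective (fieldRank (n := n) (n' := n')) := by
  rintro ⟨v1, v2⟩ ⟨w1, w2⟩ h
  have h' := toLex.injective h
  simp only [Prod.mk.injEq] at h'
  rw [ptsRank_injective h'.1, ptsRank_injective h'.2]

/-- The rooks of a graph stand in distinct rows, so their lexicographic order is the order of the
domain `A`. -/
theorem rankSign_injGraph {A : Finset (Pts n)} (f : (subsetFunctor n).obj A ⟶ b)
    {v : Pts n × Pts fun j => (b j).card} (hv : v ∈ injGraph A f) :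
    rankSign fieldRank v (injGraph A f) = rankSign ptsRank v.1 A := by
  unfold rankSign
  congr 1
  have h1 : (injGraph A f).filter (fun w => fieldRank w < fieldRank v) =
      (injGraph A f).filter fun w => ptsRank w.1 < ptsRank v.1 := by
    refine Finset.filter_congr fun w hw => ?_
    rw [fieldRank, fieldRank, Prod.Lex.toLex_lt_toLex]
    refine ⟨?_, Or.inl⟩
    rintro (h | ⟨h, h'⟩)
    · exact h
    · rw [injGraph_fst_injOn A f hw hv (ptsRank_injective h)] at h'
      exact absurd h' (lt_irrefl _)
  rw [h1, ← Finset.card_image_of_injOn (f := Prod.fst)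
    ((injGraph_fst_injOn A f).mono (Finset.coe_subset.2 (Finset.filter_subset _ _)))]
  congr 1
  conv_rhs => rw [← injGraph_image_fst A f]
  rw [Finset.filter_image]

theorem injGraph_injective
    {p q : Σ A : ULift.{u} (Finset (Pts n)), (subsetFunctor n).obj A.down ⟶ b}
    (h : injGraph p.1.down p.2 = injGraph q.1.down q.2) : p = q := by
  obtain ⟨⟨A⟩, f⟩ := p
  obtain ⟨⟨B⟩, g⟩ := q
  simp only at h
  obtain rfl : A = B := by rw [← injGraph_image_fst A f, h, injGraph_image_fst]
  congr 1
  funext j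
  refine Function.Embedding.ext fun i => ?_
  have hm : ((⟨j, ptsElt A j i⟩, ⟨j, FI.toEmb (f j) i⟩) : Pts n × Pts fun j => (b j).card) ∈
      injGraph A g := h ▸ mem_injGraph.2 ⟨j, i, rfl⟩
  obtain ⟨j', i', h'⟩ := mem_injGraph.1 hm
  simp only [Prod.mk.injEq] at h'
  obtain rfl : j = j' := congrArg Sigma.fst h'.1
  obtain rfl : i = i' := ptsElt_injective A j (by simpa using h'.1)
  exact (by simpa using h'.2 : FI.toEmb (f j) i = FI.toEmb (g j) i)

theorem exists_injGraph {σ : Finset (Pts n × Pts fun j => (b j).card)}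
    (hσ : σ ∈ rookPlacements (fun x y => x.1 = y.1) Finset.univ Finset.univ) :
    ∃ (A : Finset (Pts n)) (f : (subsetFunctor n).obj A ⟶ b), injGraph A f = σ := by
  let A := σ.image Prod.fst
  have h : ∀ j i, ∃ y : Fin (b j).card, ((⟨j, ptsElt A j i⟩, ⟨j, y⟩) :
      Pts n × Pts fun j => (b j).card) ∈ σ := by
    intro j i
    obtain ⟨⟨s, j', y⟩, hv, hs⟩ := Finset.mem_image.1 (ptsElt_mem A j i)
    obtain rfl : s = _ := hs
    obtain rfl : j = j' := (hσ.1 _ hv).2.2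
    exact ⟨y, hv⟩
  choose y hy using h
  have hinj : ∀ j, Function.Injective (y j) := by
    intro j i i' hii
    have := hσ.2 _ (hy j i) _ (hy j i') (Or.inr (by rw [hii]))
    exact ptsElt_injective A j (by simpa using congrArg Prod.fst this)
  refine ⟨A, fun j => (⟨y j, hinj j⟩ : _ ↪ Fin (b j).card), ?_⟩
  ext v
  rw [mem_injGraph]
  constructor
  · rintro ⟨j, i, rfl⟩
    exact hy j i
  · intro hv
    have hA : v.1 ∈ A := Finset.mem_image_of_mem _ hv
    obtain ⟨i, hi⟩ := exists_ptsElt (j := v.1.1) (i := v.1.2) hA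
    refine ⟨v.1.1, i, hσ.2 _ hv _ (hy v.1.1 i) (Or.inl ?_)⟩
    rw [hi]

/-- The comparison of the universal Koszul complex with the chains on a chessboard. -/
noncomputable def toChessboard (k : Type u) [CommRing k] {m : ℕ} (n : Fin m → ℕ) (b : FIProd m) :
    (koszulFree k n).obj b →ₗ[k] (Finset (Pts n × Pts fun j => (b j).card) →₀ k) :=
  Finsupp.lmapDomain k k
    fun p : Σ A : ULift.{u} (Finset (Pts n)), (subsetFunctor n).obj A.down ⟶ b =>
      injGraph p.1.down p.2

theorem toChessboard_basis (A : Finset (Pts n)) (f : (subsetFunctor n).obj A ⟶ b) :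
    toChessboard k n b (freeMod.basis k (ULift.up A) f) = Finsupp.single (injGraph A f) 1 :=
  Finsupp.mapDomain_single

theorem toChessboard_injective : Function.Injective (toChessboard k n b) :=
  Finsupp.mapDomain_injective fun _ _ h => injGraph_injective h

theorem toChessboard_boundary (z : (koszulFree k n).obj b) :
    toChessboard k n b (((koszulBoundary k n).app b).hom z) =
      simplexBoundary k fieldRank (toChessboard k n b z) := by
  suffices h : toChessboard k n b ∘ₗ ((koszulBoundary k n).app b).hom =
      simplexBoundary k fieldRank ∘ₗ toChessboard k n b from LinearMap.congr_fun h z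
  refine freeMod.linearMap_ext fun A f => ?_
  obtain ⟨A⟩ := A
  rw [LinearMap.comp_apply, LinearMap.comp_apply, toChessboard_basis, koszulBoundary_basis,
    map_sum]
  simp only [simplexBoundary, LinearMap.sum_apply]
  rw [← Finset.sum_subset (Finset.subset_univ (injGraph A f))
    fun v _ hv => contractVertex_single_of_notMem hv]
  refine (Finset.sum_nbij Prod.fst (fun v hv => ?_) (injGraph_fst_injOn A f) (fun s hs => ?_)
    fun v hv => ?_).symm
  · exact (injGraph_image_fst A f).subset (Finset.mem_image_of_mem _ hv)
  · simpa using (injGraph_image_fst A f).superset hs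
  rw [contractVertex_single_of_mem hv, map_zsmul, toChessboard_basis,
    rankSign_injGraph f hv, injGraph_erase f hv]

/-- The basis at `b` consists of partial injections. Their graphs are exactly the rook placements on
the board whose allowed fields pair elements with the same index `j`; a row of index `j` has `(b
j).card` allowed fields, whence the bound. Exactness is pulled back from the chessboard. -/
theorem koszulFree_exact (hb : ∀ j, 2 * Fintype.card (Pts n) ≤ (b j).card)
    {z : (koszulFree k n).obj b}
    (hz : z ∈ Submodule.span k {z | ∃ (A : Finset (Pts n)) (f : (subsetFunctor n).obj A ⟶ b),
      A.card < Fintype.card (Pts n) ∧ z = freeMod.basis k (ULift.up A) f})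
    (hdz : ((koszulBoundary k n).app b).hom z = 0) :
    ∃ w, ((koszulBoundary k n).app b).hom w = z := by
  obtain ⟨w, hw, hdw⟩ := chessboard_exact (k := k) (r := fun x y => x.1 = y.1)
    (e := fieldRank (n := n) (n' := fun j => (b j).card)) fieldRank_injective
    (Fintype.card (Pts n)) Finset.univ Finset.univ Finset.card_univ
    (by
      intro x _
      refine (hb x.1).trans ?_
      conv_lhs => rw [← Fintype.card_fin (b x.1).card, ← Finset.card_univ,
        ← Finset.card_map (Function.Embedding.sigmaMk (β := fun j => Fin (b j).card) x.1)]
      refine Finset.card_le_card fun y hy => ?_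
      obtain ⟨i, -, rfl⟩ := Finset.mem_map.1 hy
      simp)
    (toChessboard k n b z)
    (by
      clear hdz
      induction hz using Submodule.span_induction with
      | mem z h =>
        obtain ⟨A, f, hA, rfl⟩ := h
        rw [toChessboard_basis]
        have : injGraph A f ∈ {σ ∈ rookPlacements (fun x y => x.1 = y.1) Finset.univ Finset.univ |
            σ.card < (Finset.univ : Finset (Pts n)).card} :=
          ⟨injGraph_mem_rookPlacements A f, by rwa [card_injGraph, Finset.card_univ]⟩
        exact Finsupp.single_mem_supported k _ this
      | zero => simp
      | add x y _ _ hx hy => rw [map_add]; exact add_mem hx hy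
      | smul r x _ hx => rw [map_smul]; exact Submodule.smul_mem _ _ hx)
    (by rw [← toChessboard_boundary, hdz, map_zero])
  have hw' : w ∈ LinearMap.range (toChessboard k n b) := by
    rw [Finsupp.supported_eq_span_single] at hw
    refine Submodule.span_le.2 ?_ hw
    rintro _ ⟨σ, hσ, rfl⟩
    obtain ⟨A, f, rfl⟩ := exists_injGraph hσ
    exact ⟨_, toChessboard_basis A f⟩
  obtain ⟨w, rfl⟩ := hw'
  exact ⟨w, toChessboard_injective (by rw [toChessboard_boundary, hdw])⟩

end Universal

/-! ### Koszul chains of injective modules modulo torsion -/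

section Injective

variable {k : Type u} [CommRing k] {m : ℕ} {n : Fin m → ℕ}

/-- The inclusion of a submodule. -/
noncomputable def FISub.incl {V : FIMod k m} (W : FISub V) : W.toMod ⟶ V where
  app a := ModuleCat.ofHom (W.carrier a).subtype
  naturality _ _ _ := rfl

/-- The projection to a quotient module. -/
noncomputable def FISub.proj {V : FIMod k m} (W : FISub V) : V ⟶ W.quot where
  app a := ModuleCat.ofHom (W.carrier a).mkQ
  naturality _ _ _ := rfl

/-- A map killing the kernel of `g` is defined on the image of `g`, and injectivity extends it to
`Q`. -/
theorem exists_extension {Z Q I : FIMod k m} [Injective I] (g : Z ⟶ Q) (φ : Z ⟶ I)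
    (h : ∀ b (z : Z.obj b), (g.app b).hom z = 0 → (φ.app b).hom z = 0) :
    ∃ ψ : Q ⟶ I, g ≫ ψ = φ := by
  have hφ : kernel.ι g ≫ φ = 0 := by
    ext b : 2
    refine ModuleCat.hom_ext (LinearMap.ext fun z => h b _ ?_)
    exact congrArg (fun t : kernel g ⟶ Q => (t.app b).hom z) (kernel.condition g)
  exact ⟨(ShortComplex.exact_kernel g).descToInjective φ hφ,
    (ShortComplex.exact_kernel g).comp_descToInjective φ hφ⟩

/-- The submodule of `V` which is everything in the large degrees and zero elsewhere. -/
noncomputable def FIMod.large (V : FIMod k m) (D : ℕ) : FISub V where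
  carrier b := by
    classical exact if ∀ j, D ≤ (b j).card then ⊤ else ⊥
  map_mem {a b} f v hv := by
    split_ifs at hv ⊢ with h1 h2 h2
    · trivial
    · trivial
    · exact absurd (fun j => (h2 j).trans (FI.card_le (f j))) h1
    · rw [(Submodule.mem_bot k).1 hv, map_zero]
      exact zero_mem _

/-- The submodule of homogeneous elements in the universal Koszul complex. -/
noncomputable def koszulFreeHomog (k : Type u) [CommRing k] {m : ℕ} (n : Fin m → ℕ) (p : ℕ) :
    FISub (koszulFree k n) where
  carrier b := Submodule.span k {z | ∃ (A : Finset (Pts n)) (f : (subsetFunctor n).obj A ⟶ b),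
    A.card + p = Fintype.card (Pts n) ∧ z = freeMod.basis k (ULift.up A) f}
  map_mem {a b} g v hv := by
    induction hv using Submodule.span_induction with
    | mem v h =>
      obtain ⟨A, f, hA, rfl⟩ := h
      exact Submodule.subset_span ⟨A, f ≫ g, hA, freeMod.map_basis _ _ _⟩
    | zero => simp
    | add x y _ _ hx hy => rw [map_add]; exact add_mem hx hy
    | smul r x _ hx => rw [map_smul]; exact Submodule.smul_mem _ _ hx

/-- The submodule of homogeneous cycles in the universal Koszul complex. -/
noncomputable def koszulFreeCycles (k : Type u) [CommRing k] {m : ℕ} (n : Fin m → ℕ) (p : ℕ) :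
    FISub (koszulFree k n) where
  carrier b := (koszulFreeHomog k n p).carrier b ⊓ LinearMap.ker ((koszulBoundary k n).app b).hom
  map_mem {a b} g v hv := by
    refine ⟨(koszulFreeHomog k n p).map_mem g v hv.1, ?_⟩
    have h := NatTrans.naturality_apply (koszulBoundary k n) g v
    refine LinearMap.mem_ker.2 (h.trans ?_)
    exact (congrArg _ (LinearMap.mem_ker.1 hv.2)).trans (map_zero _)

/-- Koszul chains of an injective module are acyclic in positive degrees modulo torsion. -/
theorem koszul_exact_of_injective [NeZero m] {I : FIMod k m} [Injective I] {p : ℕ} (hp : 1 ≤ p)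
    (x : Koszul I n) (hx : x.IsHomogeneous p)
    (hdx : ∀ A, Koszul.d x A ∈ (FIMod.torsion I).carrier _) :
    ∃ t y : Koszul I n, t.IsHomogeneous p ∧ (∀ A, t A ∈ (FIMod.torsion I).carrier _) ∧
      y.IsHomogeneous (p + 1) ∧ x = t + Koszul.d y := by
  choose b f _ hf using hdx
  -- In degrees at least `D` all components of `Koszul.d x` have died, and the chessboard is large
  -- enough to be exact.
  let D : ℕ := ∑ A, ∑ j, (b A j).card + 2 * Fintype.card (Pts n)
  have hbD : ∀ A j, (b A j).card ≤ D := fun A j =>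
    (Finset.single_le_sum (f := fun j => (b A j).card) (fun _ _ => Nat.zero_le _)
      (Finset.mem_univ j)).trans ((Finset.single_le_sum (f := fun A => ∑ j, (b A j).card)
        (fun _ _ => Nat.zero_le _) (Finset.mem_univ A)).trans (Nat.le_add_right _ _))
  let U := FIMod.large (koszulFree k n) D
  let Z := koszulFreeCycles k n p
  let H := koszulFreeHomog k n p
  have hvan : ∀ c : FIProd m, (∀ j, D ≤ (c j).card) → ∀ w : (koszulFree k n).obj c,
      ((koszulHom (Koszul.d x)).app c).hom w = 0 := by
    intro c hc w
    suffices h : ((koszulHom (Koszul.d x)).app c).hom = 0 from LinearMap.congr_fun h w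
    refine freeMod.linearMap_ext fun A g => ?_
    obtain ⟨A⟩ := A
    rw [koszulHom_basis, LinearMap.zero_apply]
    exact I.map_eq_zero_of_card_le (f A) (hf A) g fun j => (hbD A j).trans (hc j)
  -- A cycle in degrees at least `D` is the boundary of some `w`, and `x` sends it to the value of
  -- `Koszul.d x` on `w`, which is zero. On cycles, `x` therefore factors through the quotient by
  -- the large part `U`.
  obtain ⟨ψ, hψ⟩ := exists_extension (Z.incl ≫ U.proj) (Z.incl ≫ koszulHom x) (by
    intro c z hz
    change U.proj.app c z.1 = 0 at hz
    change ((koszulHom x).app c).hom z.1 = 0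
    have hzU : z.1 ∈ U.carrier c := (Submodule.Quotient.mk_eq_zero _).1 hz
    by_cases hc : ∀ j, D ≤ (c j).card
    · obtain ⟨w, hw⟩ := koszulFree_exact (b := c) (z := z.1)
        (fun j => (Nat.le_add_left _ _).trans (hc j))
        (Submodule.span_mono (by
          rintro _ ⟨A, f, hA, rfl⟩
          exact ⟨A, f, by omega, rfl⟩) z.2.1) (LinearMap.mem_ker.1 z.2.2)
      rw [← hw]
      refine Eq.trans ?_ (hvan c hc w)
      rw [← koszulBoundary_comp]
      rfl
    · have h0 : z.1 = 0 := by
        simp only [U, FIMod.large] at hzU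
        rwa [if_neg hc, Submodule.mem_bot] at hzU
      rw [h0, map_zero])
  -- After subtraction of the map through the quotient, cycles are killed. The difference thus
  -- factors through the boundary, and the extension `η` provides `y`.
  obtain ⟨η, hη⟩ := exists_extension (H.incl ≫ koszulBoundary k n)
    (H.incl ≫ (koszulHom x - U.proj ≫ ψ)) (by
    intro c z hz
    have hzZ : z.1 ∈ Z.carrier c := ⟨z.2, LinearMap.mem_ker.2 hz⟩
    have := congrArg (fun t : Z.toMod ⟶ I => (t.app c).hom ⟨z.1, hzZ⟩) hψ
    change ((koszulHom x).app c).hom z.1 - ((U.proj ≫ ψ).app c).hom z.1 = 0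
    exact sub_eq_zero.2 this.symm)
  classical
  let t : Koszul I n := fun A => if A.card + p = Fintype.card (Pts n) then
    ((U.proj ≫ ψ).app _).hom (koszulUniv k n A) else 0
  let y : Koszul I n := fun A => if A.card + (p + 1) = Fintype.card (Pts n) then
    (η.app _).hom (koszulUniv k n A) else 0
  have hy : y.IsHomogeneous (p + 1) := fun A hA => if_neg hA
  refine ⟨t, y, fun A hA => if_neg hA, fun A => ?_, hy, funext fun A => ?_⟩
  · by_cases hA : A.card + p = Fintype.card (Pts n)
    · simp only [t, if_pos hA]
      -- A degree in which the quotient by `U` is zero; the summand 1 makes `g` a transition.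
      let c : FIProd m := fun j => ⟨((subsetFunctor n).obj A j).card + D + 1⟩
      let g : (subsetFunctor n).obj A ⟶ c := fun j =>
        (Fin.castLEEmb (by simp only [c]; omega) : Fin ((subsetFunctor n).obj A j).card ↪
          Fin (c j).card)
      refine ⟨c, g, (isTransition_iff g).2 ⟨0, by simp only [c]; omega⟩, ?_⟩
      refine (NatTrans.naturality_apply (U.proj ≫ ψ) g (koszulUniv k n A)).symm.trans ?_
      have : U.proj.app c (((koszulFree k n).map g).hom (koszulUniv k n A)) = 0 := by
        refine (Submodule.Quotient.mk_eq_zero _).2 ?_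
        simp only [U, FIMod.large]
        rw [if_pos fun j => by simp only [c]; omega]
        trivial
      exact (congrArg (ψ.app c).hom this).trans (map_zero _)
    · simp only [t, if_neg hA]
      exact zero_mem _
  · by_cases hA : A.card + p = Fintype.card (Pts n)
    · have hmem : koszulUniv k n A ∈ H.carrier ((subsetFunctor n).obj A) :=
        Submodule.subset_span ⟨A, 𝟙 _, hA, rfl⟩
      have h1 := congrArg (fun t : H.toMod ⟶ I => (t.app _).hom ⟨_, hmem⟩) hη
      change (η.app _).hom (((koszulBoundary k n).app _).hom (koszulUniv k n A)) =
        ((koszulHom x).app _).hom (koszulUniv k n A) -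
          ((U.proj ≫ ψ).app _).hom (koszulUniv k n A) at h1
      have h2 : ((koszulHom x).app _).hom (koszulUniv k n A) = x A :=
        congrFun (map_koszulHom_koszulUniv x) A
      have h3 : (η.app _).hom (((koszulBoundary k n).app _).hom (koszulUniv k n A)) =
          Koszul.d y A := by
        have h4 : ((koszulBoundary k n).app _).hom (koszulUniv k n A) =
            Koszul.d (koszulUniv k n) A :=
          congrFun (map_koszulHom_koszulUniv (Koszul.d (koszulUniv k n))) A
        rw [h4]
        refine (congrFun (Koszul.map_d η (koszulUniv k n)) A).trans ?_
        rw [Koszul.d_apply, Koszul.d_apply]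
        refine Finset.sum_congr rfl fun s hs => ?_
        have hcard := Finset.card_erase_add_one hs
        simp only [y]
        rw [if_pos (by omega)]
        rfl
      rw [Pi.add_apply, ← h3, h1, h2]
      simp only [t, if_pos hA]
      abel
    · rw [hx A hA, Pi.add_apply, hy.d A hA]
      simp only [t, if_neg hA, add_zero]

end Injective

/-! ### Comparison of Koszul homology with resolutions -/

section Chase

variable {k : Type u} [CommRing k] {m : ℕ} {n : Fin m → ℕ}

theorem Koszul.exists_map_eq {V W : FIMod k m} (φ : V ⟶ W) {p : ℕ} {x : Koszul W n}
    (hx : x.IsHomogeneous p) (h : ∀ A, A.card + p = Fintype.card (Pts n) →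
      ∃ v, (φ.app _).hom v = x A) :
    ∃ y : Koszul V n, y.IsHomogeneous p ∧ Koszul.map φ y = x := by
  obtain ⟨y, hy, hyx⟩ := Koszul.exists_homogeneous (V := V) (n := n) (p := p)
    (P := fun A v => (φ.app _).hom v = x A) (fun A hA => by rw [map_zero, hx A hA]) h
  exact ⟨y, hy, funext hyx⟩

theorem Koszul.map_map_eq_zero {U V W : FIMod k m} {φ : U ⟶ V} {ψ : V ⟶ W} (h : φ ≫ ψ = 0)
    (x : Koszul U n) : Koszul.map ψ (Koszul.map φ x) = 0 := by
  funext A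
  exact congrArg (fun t : U ⟶ W => (t.app _).hom (x A)) h

/-- A chase in the Koszul double complex of an augmented resolution `⋯ → E 2 → E 1 → E 0 → 0`. -/
theorem koszul_chase_left {E : ℕ → FIMod k m} (δ : ∀ q, E (q + 1) ⟶ E q)
    (hδ : ∀ q, δ (q + 1) ≫ δ q = 0)
    (hsurj : ∀ a (x : (E 0).obj a), ∃ y, ((δ 0).app a).hom y = x)
    (hex : ∀ q a (x : (E (q + 1)).obj a), ((δ q).app a).hom x = 0 →
      ∃ y, ((δ (q + 1)).app a).hom y = x)
    {i : ℕ} (hK : ∀ x : Koszul (E 0) n, x.IsHomogeneous i → Koszul.d x = 0 →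
      ∃ y : Koszul (E 0) n, y.IsHomogeneous (i + 1) ∧ Koszul.d y = x)
    (hP : ∀ q, Projective (E (q + 1))) (q : ℕ) :
    ∀ (p : ℕ), p + q = i → ∀ (x : Koszul (E (q + 1)) n) (v : Koszul (E q) n),
      x.IsHomogeneous p → v.IsHomogeneous (p + 1) → Koszul.map (δ q) x = Koszul.d v →
      ∃ (a : Koszul (E (q + 2)) n) (b : Koszul (E (q + 1)) n), a.IsHomogeneous p ∧
        b.IsHomogeneous (p + 1) ∧ x = Koszul.map (δ (q + 1)) a + Koszul.d b := by
  have hexK : ∀ q p (x : Koszul (E (q + 1)) n), x.IsHomogeneous p → Koszul.map (δ q) x = 0 →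
      ∃ a : Koszul (E (q + 2)) n, a.IsHomogeneous p ∧ Koszul.map (δ (q + 1)) a = x :=
    fun q p x hx h => Koszul.exists_map_eq _ hx fun A _ => hex q _ _ (congrFun h A)
  induction q with
  | zero =>
    intro p hp x v hx hv hxv
    obtain ⟨b, hb, hbv⟩ := Koszul.exists_map_eq (δ 0) hv fun A _ => hsurj _ (v A)
    obtain ⟨a, ha, hax⟩ := hexK 0 p (x - Koszul.d b) (hx.sub hb.d)
      (by rw [map_sub, hxv, Koszul.map_d, hbv, sub_self])
    exact ⟨a, b, ha, hb, by rw [hax, sub_add_cancel]⟩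
  | succ q ih =>
    intro p hp x v hx hv hxv
    have hdv : Koszul.d (Koszul.map (δ q) v) = 0 := by
      rw [← Koszul.map_d, ← hxv, Koszul.map_map_eq_zero (hδ q)]
    -- Only `E 0` need not be projective, and it is reached exactly in Koszul degree `i`, where `hK`
    -- applies.
    obtain ⟨v', hv', hv'v⟩ : ∃ v' : Koszul (E q) n, v'.IsHomogeneous (p + 1 + 1) ∧
        Koszul.d v' = Koszul.map (δ q) v := by
      cases q with
      | zero =>
        obtain rfl : p + 1 = i := by omega
        exact hK _ (hv.map _) hdv
      | succ q => exact koszul_exact_of_projective (by omega) _ (hv.map _) hdv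
    obtain ⟨a', b', ha', hb', hv₂⟩ := ih (p + 1) (by omega) v v' hv hv' hv'v.symm
    obtain ⟨a, ha, hax⟩ := hexK (q + 1) p (x - Koszul.d a') (hx.sub ha'.d) (by
      rw [map_sub, hxv, hv₂, map_add, Koszul.d_d, add_zero, Koszul.map_d, sub_self])
    exact ⟨a, a', ha, ha', by rw [hax, sub_add_cancel]⟩

variable [NeZero m]

/-- A Koszul chain all of whose components are torsion. -/
def Koszul.IsTorsion {V : FIMod k m} (x : Koszul V n) : Prop :=
  ∀ A, x A ∈ (FIMod.torsion V).carrier _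

theorem Koszul.IsTorsion.add {V : FIMod k m} {x y : Koszul V n} (hx : x.IsTorsion)
    (hy : y.IsTorsion) : (x + y).IsTorsion :=
  fun A => add_mem (hx A) (hy A)

theorem Koszul.IsTorsion.map {V W : FIMod k m} {x : Koszul V n} (hx : x.IsTorsion) (φ : V ⟶ W) :
    (Koszul.map φ x).IsTorsion :=
  fun A => FIMod.torsion_map φ _ _ (hx A)

theorem Koszul.IsTorsion.d {V : FIMod k m} {x : Koszul V n} (hx : x.IsTorsion) :
    (Koszul.d x).IsTorsion :=
  fun A => sum_mem fun s _ => zsmul_mem ((FIMod.torsion V).map_mem _ _ (hx (A.erase s))) _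

/-- A chase in the Koszul double complex of an injective resolution and its torsion subcomplex. -/
theorem koszul_chase_right {I : ℕ → FIMod k m} (δ : ∀ q, I q ⟶ I (q + 1))
    (hδ : ∀ q, δ q ≫ δ (q + 1) = 0) (hI : ∀ q, Injective (I q))
    (hex : ∀ q a (x : (I (q + 1)).obj a), ((δ (q + 1)).app a).hom x = 0 →
      ∃ y, ((δ q).app a).hom y = x)
    {i : ℕ} (hi : 1 ≤ i)
    (htors : ∀ (q : ℕ) (A : Finset (Pts n)), A.card + (i + (q + 1)) = Fintype.card (Pts n) →
      ∀ t ∈ (FIMod.torsion (I (q + 1))).carrier ((subsetFunctor n).obj A),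
        ((δ (q + 1)).app _).hom t = 0 →
        ∃ s ∈ (FIMod.torsion (I q)).carrier ((subsetFunctor n).obj A), ((δ q).app _).hom s = t)
    (l : ℕ) : ∀ q, Fintype.card (Pts n) < i + q + l → ∀ v : Koszul (I q) n,
      v.IsHomogeneous (i + q) → Koszul.map (δ q) v = 0 → (Koszul.d v).IsTorsion →
      ∃ t y : Koszul (I q) n, t.IsHomogeneous (i + q) ∧ y.IsHomogeneous (i + q + 1) ∧
        t.IsTorsion ∧ Koszul.map (δ q) t = 0 ∧ Koszul.map (δ q) y = 0 ∧ v = t + Koszul.d y := by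
  -- Descending induction on `q`: for large `q` there are no sets of codimension `i + q`, so `v =
  -- 0`.
  induction l with
  | zero =>
    intro q hq v hv _ _
    have h0 : v = 0 := funext fun A => hv A (by omega)
    exact ⟨0, 0, fun _ _ => rfl, fun _ _ => rfl, fun _ => zero_mem _, map_zero _, map_zero _,
      by rw [h0, map_zero, add_zero]⟩
  | succ l ih =>
    intro q hq v hv hδv hdv
    obtain ⟨t₀, y₀, ht₀, htt₀, hy₀, hv₀⟩ := koszul_exact_of_injective (by omega) v hv hdv
    have h1 : Koszul.map (δ q) t₀ + Koszul.d (Koszul.map (δ q) y₀) = 0 := by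
      rw [← Koszul.map_d, ← map_add, ← hv₀, hδv]
    -- The chain `δ y₀` is admissible for `q + 1`, since its Koszul differential is `-δ t₀`, which
    -- is torsion.
    obtain ⟨t₁, y₁, ht₁, hy₁, htt₁, hδt₁, hδy₁, hv₁⟩ := ih (q + 1) (by omega)
      (Koszul.map (δ q) y₀) (hy₀.map _) (Koszul.map_map_eq_zero (hδ q) y₀) (by
        rw [eq_neg_of_add_eq_zero_right h1]
        exact fun A => neg_mem (Koszul.IsTorsion.map htt₀ (δ q) A))
    -- Here the vanishing of local cohomology enters: the closed torsion chain `t₁` has a torsion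
    -- preimage.
    obtain ⟨s, hs, hsA⟩ := Koszul.exists_homogeneous (V := I q) (n := n) (p := i + (q + 1))
      (P := fun A v => v ∈ (FIMod.torsion (I q)).carrier _ ∧ ((δ q).app _).hom v = t₁ A)
      (fun A hA => ⟨zero_mem _, by rw [map_zero, ht₁ A hA]⟩)
      (fun A hA => htors q A hA (t₁ A) (htt₁ A) (congrFun hδt₁ A))
    have hst : Koszul.map (δ q) s = t₁ := funext fun A => (hsA A).2
    have hss : s.IsTorsion := fun A => (hsA A).1
    obtain ⟨w, hw, hwy⟩ := Koszul.exists_map_eq (δ q) hy₁ fun A _ => hex q _ _ (congrFun hδy₁ A)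
    -- Since `δ s = t₁` and `δ w = y₁`, these corrections make both terms closed under `δ`, and they
    -- cancel in the sum `t + Koszul.d y`.
    refine ⟨t₀ + Koszul.d s, y₀ - s - Koszul.d w, ht₀.add hs.d, (hy₀.sub hs).sub hw.d,
      Koszul.IsTorsion.add htt₀ hss.d, ?_, ?_, ?_⟩
    · rw [map_add, eq_neg_of_add_eq_zero_left h1, hv₁, map_add, Koszul.d_d, Koszul.map_d, hst]
      abel
    · rw [map_sub, map_sub, Koszul.map_d, hst, hwy, hv₁]
      abel
    · rw [map_sub, map_sub, Koszul.d_d, hv₀]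
      abel

end Chase

/-! ### Derived functors -/

section Derived

variable {k : Type u} [CommRing k] {m : ℕ}

/-- Evaluation at an object is exact, so homology is computed pointwise. -/
theorem subsingleton_homology_obj_iff (S : ShortComplex (FIMod k m)) (a : FIProd m) :
    Subsingleton (S.homology.obj a) ↔ ∀ x : S.X₂.obj a, (S.g.app a).hom x = 0 →
      ∃ y : S.X₁.obj a, (S.f.app a).hom y = x := by
  let F := (evaluation (FIProd m) (ModuleCat.{u} k)).obj a
  have h1 : Subsingleton (S.homology.obj a) ↔ IsZero (F.obj S.homology) :=
    (ModuleCat.isZero_iff_subsingleton (M := S.homology.obj a)).symm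
  rw [h1, ← (S.mapHomologyIso F).isZero_iff, ← ShortComplex.exact_iff_isZero_homology,
    ShortComplex.moduleCat_exact_iff]
  rfl

theorem exists_of_exact {S : ShortComplex (FIMod k m)} (hS : S.Exact) (a : FIProd m)
    (x : S.X₂.obj a) (hx : (S.g.app a).hom x = 0) : ∃ y : S.X₁.obj a, (S.f.app a).hom y = x := by
  refine (subsingleton_homology_obj_iff S a).1 ?_ x hx
  have h := (ShortComplex.exact_iff_isZero_homology S).1 hS
  exact ModuleCat.isZero_iff_subsingleton.1
    (((evaluation (FIProd m) (ModuleCat.{u} k)).obj a).map_isZero h)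

theorem subsingleton_obj_of_iso {V W : FIMod k m} (e : V ≅ W) (a : FIProd m)
    (h : Subsingleton (V.obj a)) : Subsingleton (W.obj a) :=
  (e.app a).toLinearEquiv.toEquiv.subsingleton_congr.1 h

/-- The terms of a projective resolution, augmented by the resolved module. -/
noncomputable def augX {V : FIMod k m} (P : ProjectiveResolution V) : ℕ → FIMod k m
  | 0 => V
  | q + 1 => P.complex.X q

/-- The differentials of an augmented projective resolution. -/
noncomputable def augD {V : FIMod k m} (P : ProjectiveResolution V) :
    ∀ q, augX P (q + 1) ⟶ augX P q
  | 0 => P.π.f 0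
  | q + 1 => P.complex.d (q + 1) q

variable {n : Fin m → ℕ}

/-- Together with `d_mem_lt`, this identifies the cokernel of the Koszul complex at the full set
with `H_0(V)_n`. -/
theorem exists_d_eq_of_mem_lt {V : FIMod k m}
    {v : V.obj ((subsetFunctor n).obj Finset.univ)} (hv : v ∈ (FIMod.lt V).carrier _) :
    ∃ x : Koszul V n, x.IsHomogeneous 1 ∧ Koszul.d x Finset.univ = v := by
  induction hv using Submodule.span_induction with
  | mem v h =>
    classical
    obtain ⟨a, f, w, hf, rfl⟩ := h
    obtain ⟨s, hs, t, rfl⟩ := exists_factor_erase f hf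
    refine ⟨Pi.single (Finset.univ.erase s) (rankSign ptsRank s Finset.univ • (V.map t).hom w),
      fun A hA => Pi.single_eq_of_ne ?_ _, ?_⟩
    · rintro rfl
      exact hA (Finset.card_erase_add_one hs)
    · rw [Koszul.d_apply, Finset.sum_eq_single_of_mem s hs]
      · rw [Pi.single_eq_same, map_zsmul, smul_smul, rankSign_mul_self, one_smul, V.map_comp]
        rfl
      · intro s' _ hs'
        rw [Pi.single_eq_of_ne, map_zero, smul_zero]
        intro h
        have := Finset.notMem_erase s' (Finset.univ : Finset (Pts n))
        rw [h] at this
        exact this (Finset.mem_erase.2 ⟨hs', Finset.mem_univ _⟩)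
  | zero => exact ⟨0, fun _ _ => rfl, by rw [map_zero]; rfl⟩
  | add v w _ _ hv hw =>
    obtain ⟨x, hx, rfl⟩ := hv
    obtain ⟨y, hy, rfl⟩ := hw
    exact ⟨x + y, hx.add hy, by rw [map_add]; rfl⟩
  | smul r v _ hv =>
    obtain ⟨x, hx, rfl⟩ := hv
    exact ⟨r • x, fun A hA => by rw [Pi.smul_apply, hx A hA, smul_zero], by rw [map_smul]; rfl⟩

theorem d_mem_lt {V : FIMod k m} (x : Koszul V n) (A : Finset (Pts n)) :
    Koszul.d x A ∈ (FIMod.lt V).carrier _ := by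
  refine sum_mem fun s hs => zsmul_mem (Submodule.subset_span ?_) _
  exact ⟨_, _, x (A.erase s), isTransition_subsetFunctor_erase hs _, rfl⟩

/-- Exactness of the Koszul complex implies vanishing of `FI^m`-homology. -/
theorem subsingleton_homology_of_koszul_exact {V : FIMod k m} {i : ℕ} (hi : 1 ≤ i)
    (hK : ∀ x : Koszul V n, x.IsHomogeneous i → Koszul.d x = 0 →
      ∃ y : Koszul V n, y.IsHomogeneous (i + 1) ∧ Koszul.d y = x) :
    Subsingleton ((FIHomology i V).obj (FIProd.ofVec n)) := by
  classical
  rw [← subsetFunctor_obj_univ]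
  obtain ⟨i, rfl⟩ : ∃ i', i = i' + 1 := ⟨i - 1, by omega⟩
  let P := ProjectiveResolution.of V
  let C := ((FIHomZero k m).mapHomologicalComplex _).obj P.complex
  let e : C.homology (i + 1) ≅ (C.sc' (i + 2) (i + 1) i).homology :=
    C.homologyIsoSc' (i + 2) (i + 1) i (ChainComplex.prev ℕ (i + 1)) (ChainComplex.next_nat_succ i)
  refine subsingleton_obj_of_iso ((P.isoLeftDerivedObj (FIHomZero k m) (i + 1)) ≪≫ e).symm _ ?_
  rw [subsingleton_homology_obj_iff]
  intro x hx
  obtain ⟨x, rfl⟩ := Submodule.Quotient.mk_surjective _ x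
  -- A cycle of `H_0(P)` is closed only modulo `V_{<n}`. The error is a Koszul boundary, which puts
  -- `x` in the position required by the chase.
  have hx' : ((P.complex.d (i + 1) i).app _).hom x ∈ (FIMod.lt (P.complex.X i)).carrier _ :=
    (Submodule.Quotient.mk_eq_zero _).1 hx
  obtain ⟨v, hv, hvx⟩ := exists_d_eq_of_mem_lt hx'
  obtain ⟨x₀, hhom, hx₀⟩ : ∃ x₀ : Koszul (P.complex.X (i + 1)) n, x₀.IsHomogeneous 0 ∧
      x₀ Finset.univ = x := by
    refine ⟨Pi.single Finset.univ x, fun A hA => Pi.single_eq_of_ne ?_ _, Pi.single_eq_same _ _⟩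
    rintro rfl
    exact hA Finset.card_univ
  have hδ : Koszul.map (P.complex.d (i + 1) i) x₀ = Koszul.d v := by
    funext A
    by_cases hA : A = Finset.univ
    · subst hA
      rw [Koszul.map_apply, hx₀, hvx]
    · have hc : A.card + 0 ≠ Fintype.card (Pts n) := fun h =>
        hA ((Finset.card_eq_iff_eq_univ A).1 h)
      rw [hhom.map _ A hc, hv.d A hc]
  -- The augmentation shifts indices by one: `P.complex.X (i + 1)` is the term `i + 2`, so the chase
  -- runs with `q = i + 1` and `p = 0`.
  obtain ⟨a, b, -, -, hab⟩ := koszul_chase_left (n := n) (E := augX P) (augD P)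
    (fun q => by
      cases q with
      | zero => exact P.complex_d_comp_π_f_zero
      | succ q => exact P.complex.d_comp_d (q + 2) (q + 1) q)
    (fun a x => by
      have h : Epi (P.π.f 0) := inferInstance
      have h' : Epi ((P.π.f 0).app a) := inferInstance
      exact (ModuleCat.epi_iff_surjective _).1 h' x)
    (fun q a x hx => by
      cases q with
      | zero => exact exists_of_exact P.exact₀ a x hx
      | succ q => exact exists_of_exact (P.exact_succ q) a x hx)
    hK (fun q => P.projective q) (i + 1) 0 (by omega) x₀ v hhom hv hδ
  refine ⟨Submodule.Quotient.mk (a Finset.univ), ?_⟩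
  have h1 : x = ((P.complex.d (i + 2) (i + 1)).app _).hom (a Finset.univ) +
      Koszul.d (V := P.complex.X (i + 1)) b Finset.univ := hx₀.symm.trans (congrFun hab Finset.univ)
  refine ((Submodule.Quotient.eq _).2 ?_)
  rw [h1, ← neg_mem_iff]
  change -(((P.complex.d (i + 2) (i + 1)).app _).hom (a Finset.univ) -
    (((P.complex.d (i + 2) (i + 1)).app _).hom (a Finset.univ) +
      Koszul.d (V := P.complex.X (i + 1)) b Finset.univ)) ∈ _
  rw [neg_sub, add_sub_cancel_left]
  exact d_mem_lt b _

variable [NeZero m]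

/-- Local cohomology is the cohomology of the torsion subcomplex of an injective resolution. -/
theorem exists_torsion_of_subsingleton_succ {V : FIMod k m} (I : InjectiveResolution V) (q : ℕ)
    (a : FIProd m) (h : Subsingleton ((FILocalCohomology (q + 1) V).obj a))
    (t : (I.cocomplex.X (q + 1)).obj a) (ht : t ∈ (FIMod.torsion (I.cocomplex.X (q + 1))).carrier a)
    (hdt : ((I.cocomplex.d (q + 1) (q + 2)).app a).hom t = 0) :
    ∃ s ∈ (FIMod.torsion (I.cocomplex.X q)).carrier a,
      ((I.cocomplex.d q (q + 1)).app a).hom s = t := by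
  let C := ((BTorsionFunctor k m).mapHomologicalComplex _).obj I.cocomplex
  let e : C.homology (q + 1) ≅ (C.sc' q (q + 1) (q + 2)).homology :=
    C.homologyIsoSc' q (q + 1) (q + 2) (CochainComplex.prev_nat_succ q)
      (CochainComplex.next ℕ (q + 1))
  have h1 := subsingleton_obj_of_iso ((I.isoRightDerivedObj (BTorsionFunctor k m) (q + 1)) ≪≫ e) a h
  obtain ⟨s, hs⟩ := (subsingleton_homology_obj_iff _ a).1 h1 ⟨t, ht⟩ (Subtype.ext hdt)
  exact ⟨s.1, s.2, congrArg Subtype.val hs⟩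

theorem eq_zero_of_subsingleton_zero {V : FIMod k m} (I : InjectiveResolution V)
    (a : FIProd m) (h : Subsingleton ((FILocalCohomology 0 V).obj a))
    (t : (I.cocomplex.X 0).obj a) (ht : t ∈ (FIMod.torsion (I.cocomplex.X 0)).carrier a)
    (hdt : ((I.cocomplex.d 0 1).app a).hom t = 0) : t = 0 := by
  let C := ((BTorsionFunctor k m).mapHomologicalComplex _).obj I.cocomplex
  let e : C.homology 0 ≅ (C.sc' 0 0 1).homology :=
    C.homologyIsoSc' 0 0 1 CochainComplex.prev_nat_zero (CochainComplex.next ℕ 0)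
  have h1 := subsingleton_obj_of_iso ((I.isoRightDerivedObj (BTorsionFunctor k m) 0) ≪≫ e) a h
  obtain ⟨s, hs⟩ := (subsingleton_homology_obj_iff _ a).1 h1 ⟨t, ht⟩ (Subtype.ext hdt)
  -- By convention the predecessor of degree 0 is 0 itself, with zero differential; so a closed
  -- torsion element is zero.
  have h2 : (C.sc' 0 0 1).f = 0 := C.shape 0 0 (by simp)
  rw [h2] at hs
  exact (congrArg Subtype.val hs).symm

/-- Vanishing of local cohomology implies exactness of the Koszul complex. -/
theorem koszul_exact_of_localCohomology {V : FIMod k m} {i : ℕ} (hi : 1 ≤ i)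
    (hvan : ∀ (q : ℕ) (A : Finset (Pts n)), A.card + (i + q) = Fintype.card (Pts n) →
      Subsingleton ((FILocalCohomology q V).obj ((subsetFunctor n).obj A)))
    (x : Koszul V n) (hx : x.IsHomogeneous i) (hdx : Koszul.d x = 0) :
    ∃ y : Koszul V n, y.IsHomogeneous (i + 1) ∧ Koszul.d y = x := by
  let I := InjectiveResolution.of V
  let ι : V ⟶ I.cocomplex.X 0 := I.ι.f 0
  have hι0 : ι ≫ I.cocomplex.d 0 1 = 0 := I.ι_f_zero_comp_complex_d
  have hιinj : ∀ a (v w : V.obj a), (ι.app a).hom v = (ι.app a).hom w → v = w := by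
    intro a v w h
    have h1 : Mono (I.ι.f 0) := inferInstance
    have h2 : Mono ((I.ι.f 0).app a) := inferInstance
    exact (ModuleCat.mono_iff_injective _).1 h2 h
  obtain ⟨t, y, ht, hy, htt, hδt, hδy, hxty⟩ := koszul_chase_right (n := n)
    (I := fun q => I.cocomplex.X q) (fun q => I.cocomplex.d q (q + 1))
    (fun q => I.cocomplex.d_comp_d q (q + 1) (q + 2)) (fun q => I.injective q)
    (fun q a x hx => exists_of_exact (I.exact_succ q) a x hx) hi
    (fun q A hA t ht hdt => exists_torsion_of_subsingleton_succ I q _ (hvan (q + 1) A hA) t ht hdt)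
    (Fintype.card (Pts n) + 1) 0 (by omega) (Koszul.map ι x) (hx.map ι)
    (Koszul.map_map_eq_zero hι0 x)
    (by
      rw [← Koszul.map_d, hdx, map_zero]
      exact fun A => zero_mem _)
  -- The torsion part is closed and sits in codimension `i`, where `H^0_B(V)` vanishes.
  have ht0 : t = 0 := by
    funext A
    by_cases hA : A.card + (i + 0) = Fintype.card (Pts n)
    · exact eq_zero_of_subsingleton_zero I _ (hvan 0 A hA) (t A) (htt A) (congrFun hδt A)
    · exact ht A hA
  -- The chase delivers `y` closed under `δ`, so it comes from `V`.
  obtain ⟨y', hy', rfl⟩ := Koszul.exists_map_eq ι hy fun A _ =>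
    exists_of_exact I.exact₀ _ (y A) (congrFun hδy A)
  refine ⟨y', hy', funext fun A => hιinj _ _ _ ?_⟩
  have := congrFun hxty A
  rw [ht0, zero_add, ← Koszul.map_d] at this
  exact this.symm

end Derived

/-! ### Splitting codimension vectors, and the theorem -/

theorem exists_le_sum_eq {m : ℕ} (b : Fin m → ℕ) (i : ℕ) (hi : i ≤ ∑ j, b j) :
    ∃ a : Fin m → ℕ, (∀ j, a j ≤ b j) ∧ ∑ j, a j = i := by
  induction i with
  | zero => exact ⟨0, fun _ => Nat.zero_le _, by simp⟩
  | succ i ih =>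
    obtain ⟨a, hab, ha⟩ := ih (by omega)
    obtain ⟨j, hj⟩ : ∃ j, a j < b j := by
      by_contra! h
      have := Finset.sum_le_sum fun j (_ : j ∈ Finset.univ) => h j
      omega
    refine ⟨a + Pi.single j 1, fun l => ?_, ?_⟩
    · by_cases hl : l = j
      · subst hl
        simpa using hj
      · simpa [hl] using hab l
    · simp [Finset.sum_add_distrib, ha]

theorem card_eq_sum_ptsFiber {m : ℕ} {n : Fin m → ℕ} (A : Finset (Pts n)) :
    A.card = ∑ j, (ptsFiber A j).card := by
  rw [← Finset.card_sigma]
  congr 1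
  ext ⟨j, i⟩
  simp [mem_ptsFiber]

theorem mainTheorem2 {k : Type u} [CommRing k] [IsNoetherianRing k] {m : ℕ} [NeZero m]
    (V : FIMod k m) (hV : V.IsFG) (i : ℕ) (hi : 1 ≤ i) (c : Fin m → ℤ)
    (hc : ∀ a : Fin m → ℕ, ∑ j, a j = i → (c - fun l => (a l : ℤ)) ∈ CMregPos V) :
    c ∈ HD i V := by
  rintro _ ⟨j, p, rfl⟩ n hn
  refine subsingleton_homology_of_koszul_exact hi (koszul_exact_of_localCohomology hi ?_)
  intro q A hA
  have hle : ∀ l, (ptsFiber A l).card ≤ n l := fun l => by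
    simpa using Finset.card_le_univ (ptsFiber A l)
  have hsum : ∑ l, (n l - (ptsFiber A l).card) = i + q := by
    have h1 : ∑ l, (n l - (ptsFiber A l).card) + ∑ l, (ptsFiber A l).card = ∑ l, n l := by
      rw [← Finset.sum_add_distrib]
      exact Finset.sum_congr rfl fun l _ => Nat.sub_add_cancel (hle l)
    have h2 : Fintype.card (Pts n) = ∑ l, n l := by simp
    rw [← card_eq_sum_ptsFiber] at h1
    omega
  -- Split the codimension vector of `A`: the part `a` of sum `i` selects the hypothesis `c - a ∈
  -- CMregPos V`, and the rest, of sum `q`, is the shift belonging to `H^q_B`.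
  obtain ⟨a, hab, ha⟩ := exists_le_sum_eq (fun l => n l - (ptsFiber A l).card) i (by omega)
  refine hc a ha q (fun l => n l - (ptsFiber A l).card - a l) ?_
    (fun l => ((ptsFiber A l).card : ℤ)) ⟨j, p, ?_⟩ (fun l => (ptsFiber A l).card) fun _ => rfl
  · have h1 : ∑ l, (n l - (ptsFiber A l).card - a l) + ∑ l, a l =
        ∑ l, (n l - (ptsFiber A l).card) := by
      rw [← Finset.sum_add_distrib]
      exact Finset.sum_congr rfl fun l _ => Nat.sub_add_cancel (hab l)
    omega
  · funext l
    have h1 := hn l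
    have h2 := hle l
    have h3 := hab l
    simp only [Pi.add_apply, Pi.sub_apply] at h1 ⊢
    rw [Nat.cast_sub h3, Nat.cast_sub h2]
    linarith
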